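/- Let $K$ be an algebraically closed field of characteristic zero, let $G$ be a finite abelian group with character group $\hat G=\operatorname{Hom}(G,K^\times)$, and let $A$ be a commutative semisimple left Yetter–Drinfel'd Hopf algebra over the group algebra $H=K[G]$, with coaction $\delta(a)=a^{(1)}\otimes a^{(2)}\in H\otimes A$. For $g\in G$ and $\gamma\in\hat G$ put $\phi_g(a)=g.a$ and $\psi_\gamma(a)=\gamma(a^{(1)})\,a^{(2)}$, where $\gamma$ is extended linearly to $K[G]$. For a primitive idempotent $e$ of $A$ let $$T_e=\{g\in G\mid \phi_g(e)=e\},\qquad Q_e=\{\gamma\in\hat G\mid\psi_\gamma(e)=e\},\qquad Q_e^\perp=\{g\in G\mid\gamma(g)=1\text{ for all }\gamma\in Q_e\},$$ and let the index of $e$ be the order of the group $G_e=Q_e^\perp/(T_e\cap Q_e^\perp)$. The stability set $\check O_e$ of $e$ is the set of all primitive idempotents $e'$ of $A$ with $T_e\subset T_{e'}$ and $Q_e\subset Q_{e'}$. Then $A$ is finite-dimensional, so that the dual space $A^*$ is a right Yetter–Drinfel'd Hopf algebra over $K[G]$ whose structure maps are the transposes of those of $A$, i.e. $\langle a,\varphi.h\rangle=\langle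 h.a,\varphi\rangle$, $\langle a,\varphi^{(1)}\rangle\varphi^{(2)}=a^{(1)}\langle a^{(2)},\varphi\rangle$, $\langle a,\varphi\varphi'\rangle=\varphi(a_{(1)})\varphi'(a_{(2)})$, $\langle a\otimes a',\Delta(\varphi)\rangle=\langle aa',\varphi\rangle$, $1_{A^*}=\varepsilon_A$, $\varepsilon_{A^*}(\varphi)=\varphi(1_A)$, and $S_{A^*}=S_A^*$. For every primitive idempotent $e$ of $A$ there is a unique algebra homomorphism $\eta_e:A\to K$ with $\eta_e(e)=1$ and $\eta_e(e')=0$ for all primitive idempotents $e'\neq e$. Put $\check U_e=\{\eta_{e'}\mid e'\in\check O_e\}\subset A^*$. For every primitive idempotent $e$ of $A$ the following hold. 1. $\operatorname{Span}(\check U_e)$ is a Yetter–Drinfel'd Hopf subalgebra of $A^*$, i.e. a submodule, subcomodule, unital subalgebra and subcoalgebra that is stable under the antipode. 2. If $e$ has index $1$, then $\check U_e$ is a subgroup of the group of units of $A^*$ and consists of group-like elements. The canonical map from the group algebra $K[\check U_e]$ to $A^*$ is injective with image $\operatorname{Span}(\check U_e)$, and $\operatorname{Span}(\check U_e)$ is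 a trivial Yetter–Drinfel'd Hopf subalgebra of $A^*$, i.e. its quasisymmetry $\sigma(\varphi\otimes\varphi')=\varphi'^{(1)}\otimes\varphi.\varphi'^{(2)}$ is the flip $\varphi\otimes\varphi'\mapsto\varphi'\otimes\varphi$. -/

import Mathlib

open scoped TensorProduct

noncomputable section

namespace YetterDrinfeld

/-! ### Actions, coactions and braidings on tensor products -/

section Maps

variable (K : Type*) {H V W A : Type*} [Field K] [Ring H] [HopfAlgebra K H]
  [AddCommGroup V] [Module K V] [AddCommGroup W] [Module K W] [Ring A] [Algebra K A]

/-- The diagonal action `v ⊗ w ↦ h₁.v ⊗ h₂.w` of `h` on a tensor product. -/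
def diagAct (ρ : H →ₗ[K] Module.End K V) (τ : H →ₗ[K] Module.End K W) :
    H →ₗ[K] Module.End K (V ⊗[K] W) :=
  TensorProduct.homTensorHomMap (RingHom.id K) V W V W ∘ₗ TensorProduct.map ρ τ ∘ₗ
    Coalgebra.comul

/-- The left codiagonal coaction `v ⊗ w ↦ v¹ w¹ ⊗ (v² ⊗ w²)`. -/
def leftCodiag (d : V →ₗ[K] H ⊗[K] V) (d' : W →ₗ[K] H ⊗[K] W) :
    V ⊗[K] W →ₗ[K] H ⊗[K] (V ⊗[K] W) :=
  (LinearMap.mul' K H).rTensor (V ⊗[K] W) ∘ₗ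
    (TensorProduct.tensorTensorTensorComm K H V H W).toLinearMap ∘ₗ TensorProduct.map d d'

/-- The right codiagonal coaction `v ⊗ w ↦ (v¹ ⊗ w¹) ⊗ v² w²`. -/
def rightCodiag (d : V →ₗ[K] V ⊗[K] H) (d' : W →ₗ[K] W ⊗[K] H) :
    V ⊗[K] W →ₗ[K] (V ⊗[K] W) ⊗[K] H :=
  (LinearMap.mul' K H).lTensor (V ⊗[K] W) ∘ₗ
    (TensorProduct.tensorTensorTensorComm K V H W H).toLinearMap ∘ₗ TensorProduct.map d d'

/-- The left quasisymmetry `v ⊗ w ↦ v¹.w ⊗ v²`. -/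
def leftBraid (d : V →ₗ[K] H ⊗[K] V) (τ : H →ₗ[K] Module.End K W) :
    V ⊗[K] W →ₗ[K] W ⊗[K] V :=
  (TensorProduct.lift τ).rTensor V ∘ₗ (TensorProduct.assoc K H W V).symm.toLinearMap ∘ₗ
    (TensorProduct.comm K V W).toLinearMap.lTensor H ∘ₗ
    (TensorProduct.assoc K H V W).toLinearMap ∘ₗ d.rTensor W

/-- The right quasisymmetry `v ⊗ w ↦ w¹ ⊗ v.w²`. -/
def rightBraid (ρ : H →ₗ[K] Module.End K V) (d : W →ₗ[K] W ⊗[K] H) :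
    V ⊗[K] W →ₗ[K] W ⊗[K] V :=
  (TensorProduct.lift ρ.flip).lTensor W ∘ₗ (TensorProduct.assoc K W V H).toLinearMap ∘ₗ
    (TensorProduct.comm K V W).toLinearMap.rTensor H ∘ₗ
    (TensorProduct.assoc K V W H).symm.toLinearMap ∘ₗ d.lTensor V

/-- The multiplication `(a ⊗ a') ⊗ (b ⊗ b') ↦ a σ(a' ⊗ b) b'` on `A ⊗ A` twisted by `σ`. -/
def braidedMul (σ : A ⊗[K] A →ₗ[K] A ⊗[K] A) :
    (A ⊗[K] A) ⊗[K] (A ⊗[K] A) →ₗ[K] A ⊗[K] A :=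
  TensorProduct.map (LinearMap.mul' K A) (LinearMap.mul' K A) ∘ₗ
    (TensorProduct.assoc K A A (A ⊗[K] A)).symm.toLinearMap ∘ₗ
    ((TensorProduct.assoc K A A A).toLinearMap ∘ₗ σ.rTensor A ∘ₗ
      (TensorProduct.assoc K A A A).symm.toLinearMap).lTensor A ∘ₗ
    (TensorProduct.assoc K A A (A ⊗[K] A)).toLinearMap

/-- `x ⊗ z ↦ (u ↦ x u S(z))`. -/
def leftConj : H ⊗[K] H →ₗ[K] Module.End K H :=
  TensorProduct.lift ((LinearMap.mul K (Module.End K H)).compl₁₂ (LinearMap.mul K H)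
    ((LinearMap.mul K H).flip ∘ₗ HopfAlgebra.antipode K))

/-- `x ⊗ z ↦ (u ↦ S(x) u z)`. -/
def rightConj : H ⊗[K] H →ₗ[K] Module.End K H :=
  TensorProduct.lift ((LinearMap.mul K (Module.End K H)).compl₁₂
    (LinearMap.mul K H ∘ₗ HopfAlgebra.antipode K) (LinearMap.mul K H).flip)

/-- `x ⊗ (y ⊗ z)` is sent to the map `u ⊗ v ↦ x u S(z) ⊗ y.v`. -/
def leftTwist (ρ : H →ₗ[K] Module.End K V) :
    H ⊗[K] (H ⊗[K] H) →ₗ[K] Module.End K (H ⊗[K] V) :=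
  TensorProduct.homTensorHomMap (RingHom.id K) H V H V ∘ₗ
    TensorProduct.map (leftConj K) ρ ∘ₗ (TensorProduct.assoc K H H H).symm.toLinearMap ∘ₗ
    (TensorProduct.comm K H H).toLinearMap.lTensor H

/-- `x ⊗ (y ⊗ z)` is sent to the map `v ⊗ u ↦ v.y ⊗ S(x) u z`. -/
def rightTwist (ρ : H →ₗ[K] Module.End K V) :
    H ⊗[K] (H ⊗[K] H) →ₗ[K] Module.End K (V ⊗[K] H) :=
  TensorProduct.homTensorHomMap (RingHom.id K) V H V H ∘ₗ
    TensorProduct.map ρ (rightConj K) ∘ₗ (TensorProduct.comm K (H ⊗[K] H) H).toLinearMap ∘ₗ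
    (TensorProduct.assoc K H H H).symm.toLinearMap ∘ₗ
    (TensorProduct.comm K H H).toLinearMap.lTensor H

@[simp] lemma leftCodiag_tmul (d : V →ₗ[K] H ⊗[K] V) (d' : W →ₗ[K] H ⊗[K] W) (v : V) (w : W) :
    leftCodiag K d d' (v ⊗ₜ w) = (LinearMap.mul' K H).rTensor (V ⊗[K] W)
      (TensorProduct.tensorTensorTensorComm K H V H W (d v ⊗ₜ d' w)) := rfl

@[simp] lemma rightCodiag_tmul (d : V →ₗ[K] V ⊗[K] H) (d' : W →ₗ[K] W ⊗[K] H) (v : V) (w : W) :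
    rightCodiag K d d' (v ⊗ₜ w) = (LinearMap.mul' K H).lTensor (V ⊗[K] W)
      (TensorProduct.tensorTensorTensorComm K V H W H (d v ⊗ₜ d' w)) := rfl

@[simp] lemma leftConj_tmul (x z u : H) :
    leftConj K (x ⊗ₜ z) u = x * (u * HopfAlgebra.antipode K z) := rfl

@[simp] lemma rightConj_tmul (x z u : H) :
    rightConj K (x ⊗ₜ z) u = HopfAlgebra.antipode K x * (u * z) := rfl

@[simp] lemma leftTwist_tmul (ρ : H →ₗ[K] Module.End K V) (x y z u : H) (v : V) :
    leftTwist K ρ (x ⊗ₜ (y ⊗ₜ z)) (u ⊗ₜ v) =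
      (x * (u * HopfAlgebra.antipode K z)) ⊗ₜ[K] ρ y v := rfl

@[simp] lemma rightTwist_tmul (ρ : H →ₗ[K] Module.End K V) (x y z u : H) (v : V) :
    rightTwist K ρ (x ⊗ₜ (y ⊗ₜ z)) (v ⊗ₜ u) =
      ρ y v ⊗ₜ[K] (HopfAlgebra.antipode K x * (u * z)) := rfl

end Maps

/-! ### Yetter-Drinfel'd modules and Yetter-Drinfel'd Hopf algebras -/

/-- A left-left Yetter-Drinfel'd module structure on `V`. -/
structure LeftModule (K H V : Type*) [Field K] [Ring H] [HopfAlgebra K H]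
    [AddCommGroup V] [Module K V] where
  /-- `act h v = h.v` -/
  act : H →ₗ[K] Module.End K V
  act_one : act 1 = 1
  act_mul : ∀ h h', act (h * h') = act h * act h'
  /-- `coact v = v¹ ⊗ v²` -/
  coact : V →ₗ[K] H ⊗[K] V
  coact_coassoc : ∀ v, TensorProduct.assoc K H H V
    ((Coalgebra.comul (R := K) (A := H)).rTensor V (coact v)) = coact.lTensor H (coact v)
  coact_counit : ∀ v, TensorProduct.lid K V
    ((Coalgebra.counit (R := K) (A := H)).rTensor V (coact v)) = v
  /-- `δ(h.v) = h₁ v¹ S(h₃) ⊗ h₂.v²` -/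
  compat : ∀ h v, coact (act h v) = leftTwist K act
    ((Coalgebra.comul (R := K) (A := H)).lTensor H (Coalgebra.comul h)) (coact v)

/-- A right-right Yetter-Drinfel'd module structure on `V`. -/
structure RightModule (K H V : Type*) [Field K] [Ring H] [HopfAlgebra K H]
    [AddCommGroup V] [Module K V] where
  /-- `act h v = v.h` -/
  act : H →ₗ[K] Module.End K V
  act_one : act 1 = 1
  act_mul : ∀ h h', act (h * h') = act h' * act h
  /-- `coact v = v¹ ⊗ v²` -/
  coact : V →ₗ[K] V ⊗[K] H
  coact_coassoc : ∀ v, TensorProduct.assoc K V H H (coact.rTensor H (coact v)) =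
    (Coalgebra.comul (R := K) (A := H)).lTensor V (coact v)
  coact_counit : ∀ v, TensorProduct.rid K V
    ((Coalgebra.counit (R := K) (A := H)).lTensor V (coact v)) = v
  /-- `δ(v.h) = v¹.h₂ ⊗ S(h₁) v² h₃` -/
  compat : ∀ h v, coact (act h v) = rightTwist K act
    ((Coalgebra.comul (R := K) (A := H)).lTensor H (Coalgebra.comul h)) (coact v)

/-- A left Yetter-Drinfel'd Hopf algebra structure on an algebra and coalgebra `A`. -/
structure LeftHopfAlgebra (K H A : Type*) [Field K] [Ring H] [HopfAlgebra K H]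
    [Ring A] [Algebra K A] [Coalgebra K A] extends LeftModule K H A where
  -- multiplication and unit are `H`-linear and colinear
  act_mul_eq : ∀ h a b, act h (a * b) = LinearMap.mul' K A (diagAct K act act h (a ⊗ₜ b))
  act_one_eq : ∀ h, act h 1 = Coalgebra.counit (R := K) h • (1 : A)
  coact_mul_eq : ∀ a b, coact (a * b) =
    (LinearMap.mul' K A).lTensor H (leftCodiag K coact coact (a ⊗ₜ b))
  coact_one_eq : coact 1 = 1 ⊗ₜ 1
  -- comultiplication and counit are `H`-linear and colinear
  comul_act : ∀ h a, Coalgebra.comul (act h a) = diagAct K act act h (Coalgebra.comul a)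
  counit_act : ∀ h a, Coalgebra.counit (R := K) (act h a) =
    Coalgebra.counit (R := K) h * Coalgebra.counit (R := K) a
  comul_coact : ∀ a, (Coalgebra.comul (R := K) (A := A)).lTensor H (coact a) =
    leftCodiag K coact coact (Coalgebra.comul a)
  counit_coact : ∀ a, (Coalgebra.counit (R := K) (A := A)).lTensor H (coact a) =
    1 ⊗ₜ Coalgebra.counit a
  -- comultiplication and counit are algebra homomorphisms for the braided product on `A ⊗ A`
  comul_mul : ∀ a b : A, Coalgebra.comul (R := K) (a * b) =
    braidedMul K (leftBraid K coact act) (Coalgebra.comul a ⊗ₜ Coalgebra.comul b)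
  comul_one : Coalgebra.comul (R := K) (1 : A) = 1 ⊗ₜ 1
  counit_mul : ∀ a b : A, Coalgebra.counit (R := K) (a * b) =
    Coalgebra.counit (R := K) a * Coalgebra.counit (R := K) b
  counit_one : Coalgebra.counit (R := K) (1 : A) = 1
  -- the antipode
  antipode : A →ₗ[K] A
  antipode_act : ∀ h a, antipode (act h a) = act h (antipode a)
  antipode_coact : ∀ a, coact (antipode a) = antipode.lTensor H (coact a)
  antipode_left : ∀ a, LinearMap.mul' K A (antipode.rTensor A (Coalgebra.comul a)) =
    algebraMap K A (Coalgebra.counit a)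
  antipode_right : ∀ a, LinearMap.mul' K A (antipode.lTensor A (Coalgebra.comul a)) =
    algebraMap K A (Coalgebra.counit a)

/-- A right Yetter-Drinfel'd Hopf algebra structure on an algebra and coalgebra `A`. -/
structure RightHopfAlgebra (K H A : Type*) [Field K] [Ring H] [HopfAlgebra K H]
    [Ring A] [Algebra K A] [Coalgebra K A] extends RightModule K H A where
  -- multiplication and unit are `H`-linear and colinear
  act_mul_eq : ∀ h a b, act h (a * b) = LinearMap.mul' K A (diagAct K act act h (a ⊗ₜ b))
  act_one_eq : ∀ h, act h 1 = Coalgebra.counit (R := K) h • (1 : A)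
  coact_mul_eq : ∀ a b, coact (a * b) =
    (LinearMap.mul' K A).rTensor H (rightCodiag K coact coact (a ⊗ₜ b))
  coact_one_eq : coact 1 = 1 ⊗ₜ 1
  -- comultiplication and counit are `H`-linear and colinear
  comul_act : ∀ h a, Coalgebra.comul (act h a) = diagAct K act act h (Coalgebra.comul a)
  counit_act : ∀ h a, Coalgebra.counit (R := K) (act h a) =
    Coalgebra.counit (R := K) h * Coalgebra.counit (R := K) a
  comul_coact : ∀ a, (Coalgebra.comul (R := K) (A := A)).rTensor H (coact a) =
    rightCodiag K coact coact (Coalgebra.comul a)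
  counit_coact : ∀ a, (Coalgebra.counit (R := K) (A := A)).rTensor H (coact a) =
    Coalgebra.counit a ⊗ₜ 1
  -- comultiplication and counit are algebra homomorphisms for the braided product on `A ⊗ A`
  comul_mul : ∀ a b : A, Coalgebra.comul (R := K) (a * b) =
    braidedMul K (rightBraid K act coact) (Coalgebra.comul a ⊗ₜ Coalgebra.comul b)
  comul_one : Coalgebra.comul (R := K) (1 : A) = 1 ⊗ₜ 1
  counit_mul : ∀ a b : A, Coalgebra.counit (R := K) (a * b) =
    Coalgebra.counit (R := K) a * Coalgebra.counit (R := K) b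
  counit_one : Coalgebra.counit (R := K) (1 : A) = 1
  -- the antipode
  antipode : A →ₗ[K] A
  antipode_act : ∀ h a, antipode (act h a) = act h (antipode a)
  antipode_coact : ∀ a, coact (antipode a) = antipode.rTensor H (coact a)
  antipode_left : ∀ a, LinearMap.mul' K A (antipode.rTensor A (Coalgebra.comul a)) =
    algebraMap K A (Coalgebra.counit a)
  antipode_right : ∀ a, LinearMap.mul' K A (antipode.lTensor A (Coalgebra.comul a)) =
    algebraMap K A (Coalgebra.counit a)

namespace RightHopfAlgebra

variable {K H A : Type*} [Field K] [Ring H] [HopfAlgebra K H]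
  [Ring A] [Algebra K A] [Coalgebra K A]

/-- The quasisymmetry `a ⊗ b ↦ b¹ ⊗ a.b²` of a right Yetter-Drinfel'd Hopf algebra. -/
def braid (Y : RightHopfAlgebra K H A) : A ⊗[K] A →ₗ[K] A ⊗[K] A :=
  rightBraid K Y.act Y.coact

/-- `B` is a Yetter-Drinfel'd Hopf subalgebra: a submodule, subcomodule, subalgebra and
subcoalgebra that is stable under the antipode. The spaces `B ⊗ H` and `B ⊗ B` are identified with
their images in `A ⊗ H` and `A ⊗ A`. -/
structure IsHopfSubalgebra (Y : RightHopfAlgebra K H A) (B : Submodule K A) : Prop where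
  act_mem : ∀ h, ∀ b ∈ B, Y.act h b ∈ B
  coact_mem : ∀ b ∈ B, Y.coact b ∈ LinearMap.range (B.subtype.rTensor H)
  one_mem : (1 : A) ∈ B
  mul_mem : ∀ a ∈ B, ∀ b ∈ B, a * b ∈ B
  comul_mem : ∀ b ∈ B, Coalgebra.comul (R := K) b ∈
    LinearMap.range (TensorProduct.map B.subtype B.subtype)
  antipode_mem : ∀ b ∈ B, Y.antipode b ∈ B

/-- `B` is a trivial Yetter-Drinfel'd Hopf subalgebra: its quasisymmetry, the restriction of the
one of `A`, is the flip. -/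
structure IsTrivialHopfSubalgebra (Y : RightHopfAlgebra K H A) (B : Submodule K A) : Prop
    extends Y.IsHopfSubalgebra B where
  braid_eq : ∀ a ∈ B, ∀ b ∈ B, Y.braid (a ⊗ₜ b) = b ⊗ₜ a

end RightHopfAlgebra

set_option linter.unusedSectionVars false
set_option linter.unusedSimpArgs false

/-! ### The dual of a finite-dimensional left Yetter-Drinfel'd Hopf algebra -/

section Dual

variable (K A : Type*) [Field K] [AddCommGroup A] [Module K A] [Coalgebra K A]

/-- The dual space `A*` of a coalgebra, with the convolution product
`⟨a, φψ⟩ = φ(a₁) ψ(a₂)` and the unit `ε`. -/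
def Dual : Type _ := WithConv (A →ₗ[K] K)

instance dualRing : Ring (Dual K A) := inferInstanceAs (Ring (WithConv (A →ₗ[K] K)))

instance dualAlgebra : Algebra K (Dual K A) :=
  inferInstanceAs (Algebra K (WithConv (A →ₗ[K] K)))

variable {K A}

/-- An element of `A*`, as a linear form on `A`. -/
def Dual.toLin : Dual K A ≃ₗ[K] (A →ₗ[K] K) where
  toFun φ := WithConv.ofConv φ
  invFun f := WithConv.toConv f
  map_add' _ _ := rfl
  map_smul' _ _ := rfl
  left_inv _ := rfl
  right_inv _ := rfl

instance : CoeFun (Dual K A) (fun _ => A → K) := ⟨fun φ => Dual.toLin φ⟩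

lemma toLin_mul (φ ψ : Dual K A) : (φ * ψ).toLin = LinearMap.mul' K K ∘ₗ
    TensorProduct.map φ.toLin ψ.toLin ∘ₗ Coalgebra.comul := rfl

lemma dual_mul_apply (φ ψ : Dual K A) (a : A) :
    (φ * ψ) a = LinearMap.mul' K K (TensorProduct.map φ.toLin ψ.toLin (Coalgebra.comul a)) := rfl

lemma dual_smul_apply (c : K) (φ : Dual K A) (a : A) : (c • φ) a = c • φ a := rfl

lemma toLin_zero : (0 : Dual K A).toLin = 0 := rfl

lemma toLin_one : (1 : Dual K A).toLin = Coalgebra.counit := rfl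

@[simp] lemma dual_one_apply (a : A) : (1 : Dual K A) a = Coalgebra.counit (R := K) a := rfl

end Dual

section Pairing

variable {K A : Type*} [Field K] [AddCommGroup A] [Module K A] [Coalgebra K A]

/-- The transpose of a linear endomorphism. -/
def transpose (f : A →ₗ[K] A) : Dual K A →ₗ[K] Dual K A where
  toFun φ := Dual.toLin.symm (φ.toLin ∘ₗ f)
  map_add' _ _ := rfl
  map_smul' _ _ := rfl

@[simp] lemma transpose_apply (f : A →ₗ[K] A) (φ : Dual K A) (a : A) :
    transpose f φ a = φ (f a) := rfl

lemma dual_ext {φ ψ : Dual K A} (h : ∀ a, φ a = ψ a) : φ = ψ :=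
  Dual.toLin.injective (LinearMap.ext h)

variable [FiniteDimensional K A]

variable (A) in
/-- The isomorphism `A* ⊗ W ≃ Hom(A, W)` that sends `φ ⊗ w` to `a ↦ φ(a) w`. -/
def pairEquiv (W : Type*) [AddCommMonoid W] [Module K W] :
    Dual K A ⊗[K] W ≃ₗ[K] (A →ₗ[K] W) :=
  (TensorProduct.congr (Dual.toLin) (LinearEquiv.refl K W)).trans
    (dualTensorHomEquiv K A W)

variable {W W' : Type*} [AddCommMonoid W] [Module K W] [AddCommMonoid W'] [Module K W']

@[simp] lemma pairEquiv_tmul (φ : Dual K A) (w : W) (a : A) :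
    pairEquiv A W (φ ⊗ₜ[K] w) a = φ a • w := by
  simp [pairEquiv]

lemma pair_ext {x y : Dual K A ⊗[K] W} (h : ∀ a, pairEquiv A W x a = pairEquiv A W y a) :
    x = y :=
  (pairEquiv A W).injective (LinearMap.ext h)

lemma pair_lTensor (f : W →ₗ[K] W') (x : Dual K A ⊗[K] W) (a : A) :
    pairEquiv A W' (f.lTensor _ x) a = f (pairEquiv A W x a) := by
  induction x with
  | zero => simp
  | tmul φ w => simp
  | add x y hx hy =>
    simp only [LinearMap.map_add, LinearEquiv.map_add, LinearMap.add_apply, TensorProduct.add_tmul,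
      hx, hy]

lemma pair_assoc (z : Dual K A ⊗[K] W) (w : W') (a : A) :
    pairEquiv A (W ⊗[K] W') (TensorProduct.assoc K _ W W' (z ⊗ₜ w)) a =
      pairEquiv A W z a ⊗ₜ w := by
  induction z with
  | zero => simp
  | tmul φ w => simp [TensorProduct.smul_tmul']
  | add x y hx hy =>
    simp only [LinearMap.map_add, LinearEquiv.map_add, LinearMap.add_apply, TensorProduct.add_tmul,
      hx, hy]

lemma pair_transpose (f : A →ₗ[K] A) (x : Dual K A ⊗[K] W) (a : A) :
    pairEquiv A W ((transpose f).rTensor _ x) a = pairEquiv A W x (f a) := by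
  induction x with
  | zero => simp
  | tmul φ w => simp
  | add x y hx hy =>
    simp only [LinearMap.map_add, LinearEquiv.map_add, LinearMap.add_apply, TensorProduct.add_tmul,
      hx, hy]

end Pairing

section DualCoalgebra

variable {K A : Type*} [Field K] [Ring A] [Algebra K A] [Coalgebra K A]
  [FiniteDimensional K A]

/-- The coproduct `⟨a ⊗ b, Δ(φ)⟩ = ⟨ab, φ⟩` and the counit `ε(φ) = ⟨1, φ⟩` of the dual. -/
instance dualCoalgebraStruct : CoalgebraStruct K (Dual K A) where
  comul :=
    { toFun := fun φ => (pairEquiv A (Dual K A)).symm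
        ((Dual.toLin (K := K) (A := A)).symm.toLinearMap ∘ₗ
          (LinearMap.mul K A).compr₂ φ.toLin)
      map_add' := fun φ ψ => by
        rw [← map_add]; rfl
      map_smul' := fun c φ => by
        rw [RingHom.id_apply, ← map_smul]; rfl }
  counit :=
    { toFun := fun φ => φ 1
      map_add' := fun _ _ => rfl
      map_smul' := fun _ _ => rfl }

lemma pair_comul (φ : Dual K A) (a b : A) :
    pairEquiv A (Dual K A) (Coalgebra.comul φ) a b = φ (a * b) := by
  have : pairEquiv A (Dual K A) (Coalgebra.comul φ) =
      (Dual.toLin (K := K) (A := A)).symm.toLinearMap ∘ₗ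
          (LinearMap.mul K A).compr₂ φ.toLin := LinearEquiv.apply_symm_apply _ _
  rw [this]; rfl

@[simp] lemma dual_counit (φ : Dual K A) : Coalgebra.counit (R := K) φ = φ 1 := rfl

lemma pair_pair (x : Dual K A ⊗[K] Dual K A) (y : Dual K A ⊗[K] Dual K A)
    (h : ∀ a b, pairEquiv A (Dual K A) x a b = pairEquiv A (Dual K A) y a b) : x = y :=
  pair_ext fun a => dual_ext fun b => h a b

instance dualCoalgebra : Coalgebra K (Dual K A) where
  coassoc := by
    refine LinearMap.ext fun φ => ?_
    apply pair_ext
    intro a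
    apply pair_pair
    intro b c
    have key : ∀ x : Dual K A ⊗[K] Dual K A,
        pairEquiv A (Dual K A) (pairEquiv A (Dual K A ⊗[K] Dual K A)
          (TensorProduct.assoc K _ _ _ ((Coalgebra.comul (R := K)).rTensor _ x)) a) b c =
        pairEquiv A (Dual K A) x (a * b) c := by
      intro x
      induction x with
      | zero =>
        simp only [LinearMap.map_zero, LinearEquiv.map_zero, TensorProduct.tmul_zero,
        TensorProduct.zero_tmul, LinearMap.zero_apply, LinearMap.lTensor_zero, smul_zero]
      | tmul φ ψ => simp [pair_assoc, pair_comul]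
      | add x y hx hy =>
        simp only [LinearMap.map_add, LinearEquiv.map_add, LinearMap.add_apply,
          TensorProduct.add_tmul, hx, hy]
    simp [key, pair_lTensor, pair_comul, mul_assoc]
  rTensor_counit_comp_comul := by
    refine LinearMap.ext fun φ => (TensorProduct.lid K (Dual K A)).injective (dual_ext fun b => ?_)
    have key : ∀ x : Dual K A ⊗[K] Dual K A,
        TensorProduct.lid K (Dual K A) ((Coalgebra.counit (R := K)).rTensor _ x) =
          pairEquiv A (Dual K A) x 1 := by
      intro x
      induction x with
      | zero =>
        simp only [LinearMap.map_zero, LinearEquiv.map_zero, TensorProduct.tmul_zero,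
        TensorProduct.zero_tmul, LinearMap.zero_apply, LinearMap.lTensor_zero, smul_zero]
      | tmul φ ψ => simp
      | add x y hx hy =>
        simp only [LinearMap.map_add, LinearEquiv.map_add, LinearMap.add_apply,
          TensorProduct.add_tmul, hx, hy]
    simp [key, pair_comul]
  lTensor_counit_comp_comul := by
    refine LinearMap.ext fun φ => pair_ext fun a => ?_
    simp [pair_lTensor, pair_comul]

/-- The pairing of `A* ⊗ A*` with `A ⊗ A`. -/
def tensorPair : Dual K A ⊗[K] Dual K A →ₗ[K] (A ⊗[K] A →ₗ[K] K) :=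
  (LinearMap.mul' K K).compRight K ∘ₗ TensorProduct.homTensorHomMap (RingHom.id K) A A K K ∘ₗ
    TensorProduct.map Dual.toLin.toLinearMap Dual.toLin.toLinearMap

lemma tensorPair_tmul_tmul (φ ψ : Dual K A) (a b : A) :
    tensorPair (φ ⊗ₜ[K] ψ) (a ⊗ₜ b) = φ a * ψ b := rfl

lemma tensorPair_tmul (x : Dual K A ⊗[K] Dual K A) (a b : A) :
    tensorPair x (a ⊗ₜ b) = pairEquiv A (Dual K A) x a b := by
  induction x with
  | zero =>
        simp only [LinearMap.map_zero, LinearEquiv.map_zero, TensorProduct.tmul_zero,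
        TensorProduct.zero_tmul, LinearMap.zero_apply, LinearMap.lTensor_zero, smul_zero]
  | tmul φ ψ => simp [tensorPair_tmul_tmul]
  | add x y hx hy =>
    simp only [LinearMap.map_add, LinearEquiv.map_add, LinearMap.add_apply, TensorProduct.add_tmul,
      hx, hy]

lemma tensorPair_comul (φ : Dual K A) :
    tensorPair (Coalgebra.comul φ) = φ.toLin ∘ₗ LinearMap.mul' K A := by
  ext a b
  simp [tensorPair_tmul, pair_comul]

end DualCoalgebra

/-! Helper facts about Yetter-Drinfel'd structures over a group algebra. -/

section GroupAlgebra

lemma lin_single {K G V : Type*} [Field K] [AddCommMonoid V] [Module K V] {f f' : MonoidAlgebra K G →ₗ[K] V}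
    (h : ∀ g, f (MonoidAlgebra.single g 1) = f' (MonoidAlgebra.single g 1)) (x) : f x = f' x := by
  have : f = f' := by ext g; exact h g
  rw [this]

variable {K G : Type*} [Field K] [Group G]

lemma conj_left {V : Type*} [AddCommGroup V] [Module K V]
    (X : LeftModule K (MonoidAlgebra K G) V) (g : G) (v : V) :
    X.coact (X.act (MonoidAlgebra.single g 1) v) =
      TensorProduct.map (leftConj K (MonoidAlgebra.single g 1 ⊗ₜ MonoidAlgebra.single g 1))
        (X.act (MonoidAlgebra.single g 1)) (X.coact v) := by
  rw [X.compat]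
  simp
  rfl

end GroupAlgebra

namespace LeftHopfAlgebra

variable {K H A : Type*} [Field K] [Ring H] [HopfAlgebra K H]
  [Ring A] [Algebra K A] [Coalgebra K A] [FiniteDimensional K A]

/-- The coaction of the dual: `⟨a, φ¹⟩ φ² = a¹ ⟨a², φ⟩`. -/
def dualCoact (X : LeftHopfAlgebra K H A) : Dual K A →ₗ[K] Dual K A ⊗[K] H where
  toFun φ := (pairEquiv A H).symm
    ((TensorProduct.rid K H).toLinearMap ∘ₗ φ.toLin.lTensor H ∘ₗ X.coact)
  map_add' φ ψ := by
    rw [← map_add]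
    congr 1
    ext a
    simp [LinearMap.lTensor_add]
  map_smul' c φ := by
    rw [RingHom.id_apply, ← map_smul]
    congr 1
    ext a
    simp [LinearMap.lTensor_smul]

lemma pair_dualCoact (X : LeftHopfAlgebra K H A) (φ : Dual K A) (a : A) :
    pairEquiv A H (X.dualCoact φ) a =
      TensorProduct.rid K H (φ.toLin.lTensor H (X.coact a)) := by
  have : pairEquiv A H (X.dualCoact φ) =
    ((TensorProduct.rid K H).toLinearMap ∘ₗ φ.toLin.lTensor H ∘ₗ X.coact) :=
      LinearEquiv.apply_symm_apply _ _
  rw [this]; rfl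

/-- The action of the dual: `⟨a, φ.h⟩ = ⟨h.a, φ⟩`. -/
def dualAct (X : LeftHopfAlgebra K H A) : H →ₗ[K] Module.End K (Dual K A) where
  toFun h := transpose (X.act h)
  map_add' h h' := by
    refine LinearMap.ext fun φ => dual_ext fun a => ?_
    change φ.toLin (X.act (h + h') a) = φ.toLin (X.act h a) + φ.toLin (X.act h' a)
    simp
  map_smul' c h := by
    refine LinearMap.ext fun φ => dual_ext fun a => ?_
    change φ.toLin (X.act (c • h) a) = c • φ.toLin (X.act h a)
    simp

@[simp] lemma dualAct_apply (X : LeftHopfAlgebra K H A) (h : H) (φ : Dual K A) (a : A) :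
    X.dualAct h φ a = φ (X.act h a) := rfl

lemma dual_coassoc (X : LeftHopfAlgebra K H A) (φ : Dual K A) :
    TensorProduct.assoc K (Dual K A) H H (X.dualCoact.rTensor H (X.dualCoact φ)) =
    (Coalgebra.comul (R := K) (A := H)).lTensor (Dual K A) (X.dualCoact φ) := by
  refine pair_ext fun a => ?_
  have key : ∀ x : Dual K A ⊗[K] H, pairEquiv A (H ⊗[K] H)
      (TensorProduct.assoc K (Dual K A) H H (X.dualCoact.rTensor H x)) a =
      (pairEquiv A H x).lTensor H (X.coact a) := by
    intro x
    induction x with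
    | zero =>
        simp only [LinearMap.map_zero, LinearEquiv.map_zero, TensorProduct.tmul_zero,
        TensorProduct.zero_tmul, LinearMap.zero_apply, LinearMap.lTensor_zero, smul_zero]
    | tmul φ h =>
      simp only [LinearMap.rTensor_tmul, pair_assoc, pair_dualCoact]
      induction X.coact a with
      | zero =>
        simp only [LinearMap.map_zero, LinearEquiv.map_zero, TensorProduct.tmul_zero,
        TensorProduct.zero_tmul, LinearMap.zero_apply, LinearMap.lTensor_zero, smul_zero]
      | tmul u b => simp [TensorProduct.smul_tmul]
      | add x y hx hy => simp [TensorProduct.add_tmul, ← hx, ← hy]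
    | add x y hx hy => simp [hx, hy, LinearMap.lTensor_add]
  rw [key, pair_lTensor, pair_dualCoact]
  have h1 : pairEquiv A H (X.dualCoact φ) =
    ((TensorProduct.rid K H).toLinearMap ∘ₗ φ.toLin.lTensor H) ∘ₗ X.coact :=
      LinearEquiv.apply_symm_apply _ _
  rw [h1, LinearMap.lTensor_comp_apply, ← X.coact_coassoc]
  induction X.coact a with
  | zero =>
        simp only [LinearMap.map_zero, LinearEquiv.map_zero, TensorProduct.tmul_zero,
        TensorProduct.zero_tmul, LinearMap.zero_apply, LinearMap.lTensor_zero, smul_zero]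
  | tmul u b =>
    simp only [LinearMap.rTensor_tmul, LinearMap.lTensor_tmul, TensorProduct.rid_tmul, map_smul]
    induction (Coalgebra.comul (R := K) u) with
    | zero =>
        simp only [LinearMap.map_zero, LinearEquiv.map_zero, TensorProduct.tmul_zero,
        TensorProduct.zero_tmul, LinearMap.zero_apply, LinearMap.lTensor_zero, smul_zero]
    | tmul u v => simp [TensorProduct.smul_tmul']
    | add x y hx hy => simp [TensorProduct.add_tmul, hx, hy]
  | add x y hx hy =>
    simp only [LinearMap.map_add, LinearEquiv.map_add, LinearMap.add_apply, TensorProduct.add_tmul,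
      hx, hy]

lemma dual_cocounit (X : LeftHopfAlgebra K H A) (φ : Dual K A) :
    TensorProduct.rid K (Dual K A)
      ((Coalgebra.counit (R := K) (A := H)).lTensor (Dual K A) (X.dualCoact φ)) = φ := by
  have key : ∀ x : Dual K A ⊗[K] K, ∀ a, TensorProduct.rid K (Dual K A) x a =
      pairEquiv A K x a := by
    intro x a
    induction x with
    | zero =>
        simp only [LinearMap.map_zero, LinearEquiv.map_zero, TensorProduct.tmul_zero,
        TensorProduct.zero_tmul, LinearMap.zero_apply, LinearMap.lTensor_zero, smul_zero]
    | tmul φ h => simp [mul_comm]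
    | add x y hx hy =>
      simp only [LinearMap.map_add, LinearEquiv.map_add, LinearMap.add_apply,
        TensorProduct.add_tmul, hx, hy]
  refine dual_ext fun a => ?_
  rw [key, pair_lTensor, pair_dualCoact]
  conv_rhs => rw [← X.coact_counit a]
  induction X.coact a with
  | zero =>
        simp only [LinearMap.map_zero, LinearEquiv.map_zero, TensorProduct.tmul_zero,
        TensorProduct.zero_tmul, LinearMap.zero_apply, LinearMap.lTensor_zero, smul_zero]
  | tmul u v => simp [mul_comm]
  | add x y hx hy =>
    simp only [LinearMap.map_add, LinearEquiv.map_add, LinearMap.add_apply, TensorProduct.add_tmul,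
      hx, hy]

end LeftHopfAlgebra


section DualAxioms

variable {K H A : Type*} [Field K] [Ring H] [HopfAlgebra K H] [Ring A] [Algebra K A]
  [Coalgebra K A] [FiniteDimensional K A]

namespace LeftHopfAlgebra

lemma dual_act_mul_eq (X : LeftHopfAlgebra K H A) (h : H) (φ ψ : Dual K A) :
    X.dualAct h (φ * ψ) =
      LinearMap.mul' K (Dual K A) (diagAct K X.dualAct X.dualAct h (φ ⊗ₜ ψ)) := by
  refine dual_ext fun a => ?_
  simp only [diagAct, LinearMap.comp_apply, dualAct_apply, dual_mul_apply, X.comul_act]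
  induction Coalgebra.comul (R := K) h with
  | zero => simp
  | add x y hx hy =>
    simp only [LinearMap.map_add, LinearEquiv.map_add, LinearMap.add_apply, hx, hy]
  | tmul p q =>
    simp only [TensorProduct.map_tmul, TensorProduct.homTensorHomMap_apply, LinearMap.mul'_apply,
      dual_mul_apply]
    induction Coalgebra.comul (R := K) a with
    | zero => simp
    | tmul u v => simp
    | add x y hx hy => simp only [LinearMap.map_add, LinearEquiv.map_add, hx, hy]

lemma dual_comul_act (X : LeftHopfAlgebra K H A) (h : H) (φ : Dual K A) :
    Coalgebra.comul (R := K) (X.dualAct h φ) =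
      diagAct K X.dualAct X.dualAct h (Coalgebra.comul φ) := by
  refine pair_pair _ _ fun a b => ?_
  have key : ∀ p q : H, ∀ x : Dual K A ⊗[K] Dual K A, pairEquiv A (Dual K A)
      (TensorProduct.map (X.dualAct p) (X.dualAct q) x) a b =
      pairEquiv A _ x (X.act p a) (X.act q b) := by
    intro p q x
    induction x with
    | zero => simp
    | tmul φ h => simp
    | add x y hx hy =>
      simp only [LinearMap.map_add, LinearEquiv.map_add, LinearMap.add_apply,
        TensorProduct.add_tmul, hx, hy]
  simp only [pair_comul, dualAct_apply, X.act_mul_eq, diagAct, LinearMap.comp_apply]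
  induction Coalgebra.comul (R := K) h with
  | zero => simp
  | add x y hx hy => simp only [LinearMap.map_add, LinearEquiv.map_add, LinearMap.add_apply, hx, hy]
  | tmul p q =>
    simp only [TensorProduct.map_tmul, TensorProduct.homTensorHomMap_apply, key, pair_comul,
      LinearMap.mul'_apply]

lemma dual_act_one_eq (X : LeftHopfAlgebra K H A) (h : H) :
    X.dualAct h 1 = Coalgebra.counit (R := K) h • (1 : Dual K A) := by
  refine dual_ext fun a => ?_
  simp [X.counit_act]

lemma pair_convMul (x y : Dual K A ⊗[K] H) (a : A) :
    pairEquiv A H ((LinearMap.mul' K (Dual K A)).rTensor _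
      ((LinearMap.mul' K _).lTensor _
        (TensorProduct.tensorTensorTensorComm K _ _ _ _ (x ⊗ₜ y)))) a =
    LinearMap.mul' K _ (TensorProduct.map (pairEquiv A _ x) (pairEquiv A _ y)
      (Coalgebra.comul a)) := by
  induction x with
  | zero => simp
  | add x x' hx hx' => simp [TensorProduct.add_tmul, hx, hx', TensorProduct.map_add_left]
  | tmul φ h =>
    induction y with
    | zero => simp
    | add x x' hx hx' => simp [TensorProduct.tmul_add, hx, hx', TensorProduct.map_add_right]
    | tmul ψ h' =>
      simp only [TensorProduct.tensorTensorTensorComm_tmul, LinearMap.lTensor_tmul,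
        LinearMap.rTensor_tmul, LinearMap.mul'_apply, pairEquiv_tmul, dual_mul_apply]
      induction Coalgebra.comul (R := K) a with
      | zero => simp
      | tmul u v => simp [smul_smul, mul_comm]
      | add x y hx hy => simp only [LinearMap.map_add, LinearEquiv.map_add, hx, hy, add_smul]

lemma dual_coact_mul_eq (X : LeftHopfAlgebra K H A) (φ ψ : Dual K A) :
    X.dualCoact (φ * ψ) = (LinearMap.mul' K (Dual K A)).rTensor _
      (rightCodiag K X.dualCoact X.dualCoact (φ ⊗ₜ ψ)) := by
  refine pair_ext fun a => ?_
  rw [rightCodiag_tmul, pair_convMul, pair_dualCoact]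
  rw [toLin_mul, LinearMap.lTensor_comp_apply, LinearMap.lTensor_comp_apply, X.comul_coact]
  induction Coalgebra.comul (R := K) a with
  | zero => simp
  | add x y hx hy => simp only [LinearMap.map_add, LinearEquiv.map_add, hx, hy]
  | tmul u v =>
    simp only [leftCodiag_tmul, TensorProduct.map_tmul, pair_dualCoact]
    induction X.coact u with
    | zero => simp
    | add x y hx hy => simp only [TensorProduct.add_tmul, LinearMap.map_add, LinearEquiv.map_add,
      hx, hy]
    | tmul u u' =>
      induction X.coact v with
      | zero => simp
      | add x y hx hy => simp only [TensorProduct.tmul_add, LinearMap.map_add, LinearEquiv.map_add,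
        hx, hy]
      | tmul v v' => simp [smul_smul, mul_comm]

lemma dual_coact_one_eq (X : LeftHopfAlgebra K H A) :
    X.dualCoact (1 : Dual K A) = 1 ⊗ₜ 1 := by
  refine pair_ext fun a => ?_
  rw [pair_dualCoact]
  rw [toLin_one, X.counit_coact]
  simp

lemma dual_comul_coact (X : LeftHopfAlgebra K H A) (φ : Dual K A) :
    (Coalgebra.comul (R := K) (A := Dual K A)).rTensor _ (X.dualCoact φ) =
      rightCodiag K X.dualCoact X.dualCoact (Coalgebra.comul φ) := by
  apply (TensorProduct.assoc K (Dual K A) (Dual K A) H).injective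
  refine pair_ext fun a => pair_ext fun b => ?_
  have key : ∀ x : Dual K A ⊗[K] H,
      pairEquiv A _ (pairEquiv A _ (TensorProduct.assoc K (Dual K A) (Dual K A) _
        ((Coalgebra.comul (R := K) (A := Dual K A)).rTensor _ x)) a) b =
      pairEquiv A _ x (a * b) := by
    intro x
    induction x with
    | zero =>
        simp only [LinearMap.map_zero, LinearEquiv.map_zero, TensorProduct.tmul_zero, toLin_zero,
          TensorProduct.zero_tmul, LinearMap.zero_apply, mul_zero, zero_mul, zero_smul, smul_zero,
          LinearMap.lTensor_zero, LinearMap.rTensor_zero, TensorProduct.map_zero_left,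
          TensorProduct.map_zero_right, LinearMap.comp_zero, LinearMap.zero_comp]
    | tmul φ h => simp [pair_assoc, pair_comul]
    | add x y hx hy =>
      simp only [LinearMap.map_add, LinearEquiv.map_add, LinearMap.add_apply,
        TensorProduct.add_tmul, hx, hy]
  have key2 : ∀ x y : Dual K A ⊗[K] H,
      pairEquiv A _ (pairEquiv A _ (TensorProduct.assoc K (Dual K A) (Dual K A) _
        ((LinearMap.mul' K _).lTensor _
          (TensorProduct.tensorTensorTensorComm K _ _ _ _ (x ⊗ₜ y)))) a) b =
      pairEquiv A _ x a * pairEquiv A _ y b := by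
    intro x y
    induction x with
    | zero =>
        simp only [LinearMap.map_zero, LinearEquiv.map_zero, TensorProduct.tmul_zero, toLin_zero,
          TensorProduct.zero_tmul, LinearMap.zero_apply, mul_zero, zero_mul, zero_smul, smul_zero,
          LinearMap.lTensor_zero, LinearMap.rTensor_zero, TensorProduct.map_zero_left,
          TensorProduct.map_zero_right, LinearMap.comp_zero, LinearMap.zero_comp]
    | add x x' hx hx' => simp [TensorProduct.add_tmul, hx, hx', add_mul]
    | tmul φ h =>
      induction y with
      | zero =>
        simp only [LinearMap.map_zero, LinearEquiv.map_zero, TensorProduct.tmul_zero, toLin_zero,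
          TensorProduct.zero_tmul, LinearMap.zero_apply, mul_zero, zero_mul, zero_smul, smul_zero,
          LinearMap.lTensor_zero, LinearMap.rTensor_zero, TensorProduct.map_zero_left,
          TensorProduct.map_zero_right, LinearMap.comp_zero, LinearMap.zero_comp]
      | add x x' hx hx' => simp [TensorProduct.tmul_add, hx, hx', mul_add]
      | tmul ψ h' => simp [smul_smul, mul_comm]
  have key3 : ∀ x : Dual K A ⊗[K] Dual K A,
      pairEquiv A _ (pairEquiv A _ (TensorProduct.assoc K (Dual K A) (Dual K A) _
        (rightCodiag K X.dualCoact X.dualCoact x)) a) b =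
      TensorProduct.rid K _ (LinearMap.lTensor _ (tensorPair x)
        (leftCodiag K X.coact X.coact (a ⊗ₜ b))) := by
    intro x
    induction x with
    | zero =>
        simp only [LinearMap.map_zero, LinearEquiv.map_zero, TensorProduct.tmul_zero, toLin_zero,
          TensorProduct.zero_tmul, LinearMap.zero_apply, mul_zero, zero_mul, zero_smul, smul_zero,
          LinearMap.lTensor_zero, LinearMap.rTensor_zero, TensorProduct.map_zero_left,
          TensorProduct.map_zero_right, LinearMap.comp_zero, LinearMap.zero_comp]
    | add x x' hx hx' => simp only [LinearMap.map_add, LinearEquiv.map_add, LinearMap.add_apply,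
      hx, hx', LinearMap.lTensor_add]
    | tmul φ ψ =>
      rw [rightCodiag_tmul, key2, pair_dualCoact, pair_dualCoact, leftCodiag_tmul]
      induction X.coact a with
      | zero =>
        simp only [LinearMap.map_zero, LinearEquiv.map_zero, TensorProduct.tmul_zero, toLin_zero,
          TensorProduct.zero_tmul, LinearMap.zero_apply, mul_zero, zero_mul, zero_smul, smul_zero,
          LinearMap.lTensor_zero, LinearMap.rTensor_zero, TensorProduct.map_zero_left,
          TensorProduct.map_zero_right, LinearMap.comp_zero, LinearMap.zero_comp]
      | add x y hx hy => simp only [TensorProduct.add_tmul, LinearMap.map_add, LinearEquiv.map_add,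
        ← hx, ← hy, add_mul]
      | tmul u u' =>
        induction X.coact b with
        | zero =>
        simp only [LinearMap.map_zero, LinearEquiv.map_zero, TensorProduct.tmul_zero, toLin_zero,
          TensorProduct.zero_tmul, LinearMap.zero_apply, mul_zero, zero_mul, zero_smul, smul_zero,
          LinearMap.lTensor_zero, LinearMap.rTensor_zero, TensorProduct.map_zero_left,
          TensorProduct.map_zero_right, LinearMap.comp_zero, LinearMap.zero_comp]
        | add x y hx hy => simp only [TensorProduct.tmul_add, LinearMap.map_add,
          LinearEquiv.map_add, ← hx, ← hy, mul_add]
        | tmul v v' => simp [smul_smul, mul_comm, tensorPair_tmul_tmul]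
  rw [key, key3, tensorPair_comul, LinearMap.lTensor_comp_apply, ← X.coact_mul_eq, pair_dualCoact]

lemma dual_counit_coact (X : LeftHopfAlgebra K H A) (φ : Dual K A) :
    (Coalgebra.counit (R := K) (A := Dual K A)).rTensor _ (X.dualCoact φ) =
      Coalgebra.counit φ ⊗ₜ 1 := by
  apply (TensorProduct.lid K H).injective
  have key : ∀ x : Dual K A ⊗[K] H, TensorProduct.lid K _
      ((Coalgebra.counit (R := K) (A := Dual K A)).rTensor _ x) = pairEquiv A _ x 1 := by
    intro x
    induction x with
    | zero => simp
    | tmul φ h => simp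
    | add x y hx hy =>
      simp only [LinearMap.map_add, LinearEquiv.map_add, LinearMap.add_apply,
        TensorProduct.add_tmul, hx, hy]
  rw [key, pair_dualCoact, X.coact_one_eq]
  simp

/-- `(p ⊗ q) ⊗ (r ⊗ s) ↦ p ⊗ ((q ⊗ r) ⊗ s)` -/
def shuffle (K A : Type*) [Field K] [AddCommGroup A] [Module K A] :
    (A ⊗[K] A) ⊗[K] (A ⊗[K] A) →ₗ[K] A ⊗[K] ((A ⊗[K] A) ⊗[K] A) :=
  (TensorProduct.assoc K A A A).symm.toLinearMap.lTensor A ∘ₗ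
    (TensorProduct.assoc K A A (A ⊗[K] A)).toLinearMap

/-- `p ⊗ ((q ⊗ r) ⊗ s) ↦ p q ⊗ r s` -/
def mulMul (K A : Type*) [Field K] [Ring A] [Algebra K A] :
    A ⊗[K] ((A ⊗[K] A) ⊗[K] A) →ₗ[K] A ⊗[K] A :=
  TensorProduct.map (LinearMap.mul' K A) (LinearMap.mul' K A) ∘ₗ
    (TensorProduct.assoc K A A (A ⊗[K] A)).symm.toLinearMap ∘ₗ
    (TensorProduct.assoc K A A A).toLinearMap.lTensor A

lemma braidedMul_eq {A : Type*} [Ring A] [Algebra K A] (σ : A ⊗[K] A →ₗ[K] A ⊗[K] A) (x) :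
    braidedMul K σ x = mulMul K A ((σ.rTensor A).lTensor A (shuffle K A x)) := by
  simp [braidedMul, mulMul, shuffle, LinearMap.lTensor_comp_apply]

lemma pair_braid (X : LeftHopfAlgebra K H A) (a b : A) (α β γ : Dual K A)
    (z : Dual K A ⊗[K] H) :
    pairEquiv A (Dual K A) (mulMul K (Dual K A) (α ⊗ₜ
      ((((TensorProduct.lift X.dualAct.flip).lTensor _ (TensorProduct.assoc K _ _ _
        ((TensorProduct.comm K _ _).toLinearMap.rTensor _
        ((TensorProduct.assoc K _ _ _).symm (β ⊗ₜ z)))))) ⊗ₜ γ))) a b =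
    (LinearMap.mul' K K ∘ₗ TensorProduct.map α.toLin (LinearMap.mul' K K ∘ₗ
      TensorProduct.map (β.toLin ∘ₗ TensorProduct.lift X.act ∘ₗ (pairEquiv A _ z).rTensor A)
        γ.toLin)) (shuffle K A (Coalgebra.comul a ⊗ₜ Coalgebra.comul b)) := by
  induction z with
  | zero =>
        simp only [LinearMap.map_zero, LinearEquiv.map_zero, TensorProduct.tmul_zero, toLin_zero,
          TensorProduct.zero_tmul, LinearMap.zero_apply, mul_zero, zero_mul, zero_smul, smul_zero,
          LinearMap.lTensor_zero, LinearMap.rTensor_zero, TensorProduct.map_zero_left,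
          TensorProduct.map_zero_right, LinearMap.comp_zero, LinearMap.zero_comp]
  | add x y hx hy =>
    simp only [LinearMap.map_add, LinearEquiv.map_add, TensorProduct.tmul_add,
      TensorProduct.add_tmul, LinearMap.add_apply,
      hx, hy, LinearMap.rTensor_add, LinearMap.comp_add,
      TensorProduct.map_add_left, TensorProduct.map_add_right]
  | tmul χ h =>
    simp only [mulMul, TensorProduct.assoc_symm_tmul, LinearMap.rTensor_tmul,
      LinearEquiv.coe_coe, TensorProduct.comm_tmul, TensorProduct.assoc_tmul,
      LinearMap.lTensor_tmul, TensorProduct.lift.tmul, LinearMap.comp_apply,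
      TensorProduct.map_tmul, LinearMap.mul'_apply, pairEquiv_tmul,
      dual_smul_apply, dual_mul_apply, LinearMap.flip_apply, shuffle]
    induction Coalgebra.comul (R := K) a with
    | zero =>
        simp only [LinearMap.map_zero, LinearEquiv.map_zero, TensorProduct.tmul_zero, toLin_zero,
          TensorProduct.zero_tmul, LinearMap.zero_apply, mul_zero, zero_mul, zero_smul, smul_zero,
          LinearMap.lTensor_zero, LinearMap.rTensor_zero, TensorProduct.map_zero_left,
          TensorProduct.map_zero_right, LinearMap.comp_zero, LinearMap.zero_comp]
    | add x y hx hy => simp only [TensorProduct.add_tmul, LinearMap.map_add, LinearEquiv.map_add,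
      ← hx, ← hy, add_smul]
    | tmul p q =>
      induction Coalgebra.comul (R := K) b with
      | zero =>
        simp only [LinearMap.map_zero, LinearEquiv.map_zero, TensorProduct.tmul_zero, toLin_zero,
          TensorProduct.zero_tmul, LinearMap.zero_apply, mul_zero, zero_mul, zero_smul, smul_zero,
          LinearMap.lTensor_zero, LinearMap.rTensor_zero, TensorProduct.map_zero_left,
          TensorProduct.map_zero_right, LinearMap.comp_zero, LinearMap.zero_comp]
      | add x y hx hy => simp only [TensorProduct.tmul_add, LinearMap.map_add, LinearEquiv.map_add,
        ← hx, ← hy, smul_add]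
      | tmul r s =>
        simp [mul_assoc, mul_left_comm]

lemma dual_comul_mul (X : LeftHopfAlgebra K H A) (φ ψ : Dual K A) :
    Coalgebra.comul (R := K) (φ * ψ) =
      braidedMul K (rightBraid K X.dualAct X.dualCoact)
        (Coalgebra.comul φ ⊗ₜ Coalgebra.comul ψ) := by
  refine pair_pair _ _ fun a b => ?_
  have h2 : ∀ x y : Dual K A ⊗[K] Dual K A,
      pairEquiv A (Dual K A) (braidedMul K (rightBraid K X.dualAct X.dualCoact) (x ⊗ₜ y)) a b =
      (LinearMap.mul' K K ∘ₗ TensorProduct.map (tensorPair x) (tensorPair y))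
        ((TensorProduct.assoc K A A (A ⊗[K] A)).symm
          ((TensorProduct.assoc K A A A).toLinearMap.lTensor A
          (((leftBraid K X.coact X.act).rTensor A).lTensor A
            (shuffle K A (Coalgebra.comul a ⊗ₜ Coalgebra.comul b))))) := by
    intro x y
    induction x with
    | zero =>
        simp only [LinearMap.map_zero, LinearEquiv.map_zero, TensorProduct.tmul_zero, toLin_zero,
          TensorProduct.zero_tmul, LinearMap.zero_apply, mul_zero, zero_mul, zero_smul, smul_zero,
          LinearMap.lTensor_zero, LinearMap.rTensor_zero, TensorProduct.map_zero_left,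
          TensorProduct.map_zero_right, LinearMap.comp_zero, LinearMap.zero_comp]
    | add x x' hx hx' =>
      simp only [TensorProduct.add_tmul, LinearMap.map_add, LinearEquiv.map_add,
        LinearMap.add_apply,
        TensorProduct.map_add_left, LinearMap.comp_add, hx, hx']
    | tmul α β =>
      induction y with
      | zero =>
        simp only [LinearMap.map_zero, LinearEquiv.map_zero, TensorProduct.tmul_zero, toLin_zero,
          TensorProduct.zero_tmul, LinearMap.zero_apply, mul_zero, zero_mul, zero_smul, smul_zero,
          LinearMap.lTensor_zero, LinearMap.rTensor_zero, TensorProduct.map_zero_left,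
          TensorProduct.map_zero_right, LinearMap.comp_zero, LinearMap.zero_comp]
      | add x x' hx hx' =>
        simp only [TensorProduct.tmul_add, LinearMap.map_add, LinearEquiv.map_add,
          LinearMap.add_apply,
          TensorProduct.map_add_right, LinearMap.comp_add, hx, hx']
      | tmul χ γ =>
        rw [braidedMul_eq]
        have h1 := X.pair_braid a b α β γ (X.dualCoact χ)
        refine Eq.trans ?_ (h1.trans ?_)
        · rfl
        induction shuffle K A (Coalgebra.comul (R := K) a ⊗ₜ Coalgebra.comul (R := K) b) with
        | zero =>
        simp only [LinearMap.map_zero, LinearEquiv.map_zero, TensorProduct.tmul_zero, toLin_zero,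
          TensorProduct.zero_tmul, LinearMap.zero_apply, mul_zero, zero_mul, zero_smul, smul_zero,
          LinearMap.lTensor_zero, LinearMap.rTensor_zero, TensorProduct.map_zero_left,
          TensorProduct.map_zero_right, LinearMap.comp_zero, LinearMap.zero_comp]
        | add x y hx hy => simp only [LinearMap.map_add, LinearEquiv.map_add, hx, hy]
        | tmul p w =>
          induction w with
          | zero =>
        simp only [LinearMap.map_zero, LinearEquiv.map_zero, TensorProduct.tmul_zero, toLin_zero,
          TensorProduct.zero_tmul, LinearMap.zero_apply, mul_zero, zero_mul, zero_smul, smul_zero,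
          LinearMap.lTensor_zero, LinearMap.rTensor_zero, TensorProduct.map_zero_left,
          TensorProduct.map_zero_right, LinearMap.comp_zero, LinearMap.zero_comp]
          | add x y hx hy => simp only [TensorProduct.tmul_add, LinearMap.map_add,
            LinearEquiv.map_add, hx, hy]
          | tmul w s =>
            induction w with
            | zero =>
        simp only [LinearMap.map_zero, LinearEquiv.map_zero, TensorProduct.tmul_zero, toLin_zero,
          TensorProduct.zero_tmul, LinearMap.zero_apply, mul_zero, zero_mul, zero_smul, smul_zero,
          LinearMap.lTensor_zero, LinearMap.rTensor_zero, TensorProduct.map_zero_left,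
          TensorProduct.map_zero_right, LinearMap.comp_zero, LinearMap.zero_comp]
            | add x y hx hy =>
              simp only [TensorProduct.tmul_add, TensorProduct.add_tmul, LinearMap.map_add,
                LinearEquiv.map_add, hx, hy]
            | tmul q r =>
              simp only [leftBraid, LinearMap.comp_apply, TensorProduct.map_tmul,
                LinearMap.lTensor_tmul, LinearMap.rTensor_tmul, LinearMap.mul'_apply,
                pair_dualCoact, LinearEquiv.coe_coe]
              induction X.coact q with
              | zero => simp only [LinearMap.map_zero, LinearEquiv.map_zero,
                TensorProduct.tmul_zero,
        TensorProduct.zero_tmul, LinearMap.zero_apply, mul_zero, zero_mul, zero_smul, smul_zero,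
        LinearMap.lTensor_zero, LinearMap.rTensor_zero, TensorProduct.map_zero_left,
        TensorProduct.map_zero_right, LinearMap.comp_zero, LinearMap.zero_comp, toLin_zero]
              | add x y hx hy =>
                simp only [TensorProduct.tmul_add, TensorProduct.add_tmul, LinearMap.map_add,
                  LinearEquiv.map_add, ← hx, ← hy,
                  mul_add, add_mul]
              | tmul t q =>
                simp [tensorPair_tmul_tmul, mul_assoc, mul_left_comm]
  rw [h2, tensorPair_comul, tensorPair_comul, pair_comul, dual_mul_apply, X.comul_mul,
    braidedMul_eq, mulMul, TensorProduct.map_comp]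
  rfl

lemma dual_comul_one (X : LeftHopfAlgebra K H A) :
    Coalgebra.comul (R := K) (1 : Dual K A) = 1 ⊗ₜ 1 := by
  refine pair_pair _ _ fun a b => ?_
  rw [pair_comul]
  simp [X.counit_mul]

lemma convMul'_apply (x : Dual K A ⊗[K] Dual K A) (a : A) :
    LinearMap.mul' K (Dual K A) x a = tensorPair x (Coalgebra.comul a) := by
  induction x with
  | zero => simp
  | add x y hx hy =>
    simp only [LinearMap.map_add, LinearEquiv.map_add, LinearMap.add_apply, TensorProduct.add_tmul,
      hx, hy]
  | tmul φ ψ => rfl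

lemma tensorPair_rTensor (f : A →ₗ[K] A) (x : Dual K A ⊗[K] Dual K A) :
    tensorPair ((transpose f).rTensor _ x) = tensorPair x ∘ₗ f.rTensor A := by
  ext a b
  simp [tensorPair_tmul, pair_transpose]

lemma tensorPair_lTensor (f : A →ₗ[K] A) (x : Dual K A ⊗[K] Dual K A) :
    tensorPair ((transpose f).lTensor _ x) = tensorPair x ∘ₗ f.lTensor A := by
  ext a b
  simp [tensorPair_tmul, pair_lTensor]

end LeftHopfAlgebra
end DualAxioms

section DualHopfAlgebra

variable {K G A : Type*} [Field K] [Group G] [Ring A] [Algebra K A] [Coalgebra K A]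
  [FiniteDimensional K A]

namespace LeftHopfAlgebra

lemma dual_compat (X : LeftHopfAlgebra K (MonoidAlgebra K G) A) (h : MonoidAlgebra K G)
    (φ : Dual K A) : X.dualCoact (X.dualAct h φ) = rightTwist K X.dualAct
    ((Coalgebra.comul (R := K) (A := MonoidAlgebra K G)).lTensor _ (Coalgebra.comul h))
      (X.dualCoact φ) := by
  refine lin_single (f := X.dualCoact ∘ₗ X.dualAct.flip φ)
    (f' := (rightTwist K X.dualAct).flip (X.dualCoact φ) ∘ₗ
      (Coalgebra.comul (R := K) (A := MonoidAlgebra K G)).lTensor _ ∘ₗ Coalgebra.comul)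
    (fun g => ?_) h
  refine pair_ext fun a => ?_
  have key : ∀ x : Dual K A ⊗[K] MonoidAlgebra K G, pairEquiv A (MonoidAlgebra K G)
      (TensorProduct.map (X.dualAct (MonoidAlgebra.single g 1))
        (rightConj K (MonoidAlgebra.single g 1 ⊗ₜ MonoidAlgebra.single g 1)) x) a =
      rightConj K (MonoidAlgebra.single g 1 ⊗ₜ MonoidAlgebra.single g 1)
        (pairEquiv A _ x (X.act (MonoidAlgebra.single g 1) a)) := by
    intro x
    induction x with
    | zero => simp
    | tmul φ h => simp
    | add x y hx hy => simp only [LinearMap.map_add, LinearEquiv.map_add, LinearMap.add_apply, hx,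
      hy]
  trans pairEquiv A (MonoidAlgebra K G)
      (TensorProduct.map (X.dualAct (MonoidAlgebra.single g 1))
        (rightConj K (MonoidAlgebra.single g 1 ⊗ₜ MonoidAlgebra.single g 1)) (X.dualCoact φ)) a
  · rw [key, pair_dualCoact, conj_left]
    simp only [LinearMap.comp_apply, LinearMap.flip_apply, pair_dualCoact]
    induction X.coact a with
    | zero => simp
    | tmul u v =>
      simp only [LinearMap.lTensor_tmul, TensorProduct.map_tmul, TensorProduct.rid_tmul, map_smul,
        leftConj_tmul, rightConj_tmul, MonoidAlgebra.antipode_single, ← mul_assoc,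
        MonoidAlgebra.single_mul_single]
      simp [mul_assoc, MonoidAlgebra.single_mul_single, ← MonoidAlgebra.one_def]
    | add x y hx hy => simp only [LinearMap.map_add, LinearEquiv.map_add, hx, hy]
  · congr 2
    simp
    rfl

/-- The dual of a finite-dimensional left Yetter-Drinfel'd Hopf algebra over a group algebra, as a
right Yetter-Drinfel'd Hopf algebra: the action, coaction, product, coproduct and antipode are the
transposes of those of `A`. -/
def dual (X : LeftHopfAlgebra K (MonoidAlgebra K G) A) :
    RightHopfAlgebra K (MonoidAlgebra K G) (Dual K A) where
  act := X.dualAct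
  act_one := by
    refine LinearMap.ext fun φ => dual_ext fun a => ?_
    simp [X.act_one]
  act_mul h h' := by
    refine LinearMap.ext fun φ => dual_ext fun a => ?_
    simp [X.act_mul]
  coact := X.dualCoact
  coact_coassoc := X.dual_coassoc
  coact_counit := X.dual_cocounit
  compat := X.dual_compat
  act_mul_eq := X.dual_act_mul_eq
  act_one_eq := X.dual_act_one_eq
  coact_mul_eq := X.dual_coact_mul_eq
  coact_one_eq := X.dual_coact_one_eq
  comul_act := X.dual_comul_act
  counit_act h φ := by
    simp [X.act_one_eq]
  comul_coact := X.dual_comul_coact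
  counit_coact := X.dual_counit_coact
  comul_mul := X.dual_comul_mul
  comul_one := X.dual_comul_one
  counit_mul φ ψ := by
    simp [X.comul_one, dual_mul_apply]
  counit_one := by
    simp [X.counit_one]
  antipode := transpose X.antipode
  antipode_act h φ := by
    refine dual_ext fun a => ?_
    simp [X.antipode_act]
  antipode_coact φ := by
    refine pair_ext fun a => ?_
    rw [pair_transpose, pair_dualCoact, pair_dualCoact, X.antipode_coact,
      ← LinearMap.lTensor_comp_apply]
    rfl
  antipode_left φ := by
    refine dual_ext fun a => ?_
    rw [convMul'_apply, tensorPair_rTensor, tensorPair_comul]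
    simp [X.antipode_left, Algebra.algebraMap_eq_smul_one, mul_comm]
  antipode_right φ := by
    refine dual_ext fun a => ?_
    rw [convMul'_apply, tensorPair_lTensor, tensorPair_comul]
    simp [X.antipode_right, Algebra.algebraMap_eq_smul_one, mul_comm]

end LeftHopfAlgebra
end DualHopfAlgebra

/-! ### Yetter-Drinfel'd modules over the group algebra of an abelian group -/

section AbelianGroup

variable {K G V : Type*} [Field K] [CommGroup G] [AddCommGroup V] [Module K V]

/-- The linear extension of a character `γ : G → Kˣ` to the group algebra. -/
def charLin (γ : G →* Kˣ) : MonoidAlgebra K G →ₐ[K] K :=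
  MonoidAlgebra.lift K K G ((Units.coeHom K).comp γ)

@[simp] lemma charLin_single (γ : G →* Kˣ) (g : G) (c : K) :
    charLin γ (MonoidAlgebra.single g c) = c * γ g := by
  simp [charLin, MonoidAlgebra.lift_single]

namespace LeftModule

/-- `φ_g(v) = g.v` -/
def phi (X : LeftModule K (MonoidAlgebra K G) V) (g : G) : V →ₗ[K] V :=
  X.act (MonoidAlgebra.single g 1)

/-- `ψ_γ(v) = γ(v¹) v²` -/
def psi (X : LeftModule K (MonoidAlgebra K G) V) (γ : G →* Kˣ) : V →ₗ[K] V :=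
  (TensorProduct.lid K V).toLinearMap ∘ₗ (charLin γ).toLinearMap.rTensor V ∘ₗ X.coact

lemma phi_one (X : LeftModule K (MonoidAlgebra K G) V) (v : V) : X.phi 1 v = v := by
  rw [phi, ← MonoidAlgebra.one_def, X.act_one]
  rfl

lemma phi_mul (X : LeftModule K (MonoidAlgebra K G) V) (g h : G) (v : V) :
    X.phi (g * h) v = X.phi g (X.phi h v) := by
  have : MonoidAlgebra.single (g * h) (1 : K) =
      MonoidAlgebra.single g 1 * MonoidAlgebra.single h 1 := by
    simp [MonoidAlgebra.single_mul_single]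
  rw [phi, this, X.act_mul]
  rfl

lemma psi_one (X : LeftModule K (MonoidAlgebra K G) V) (v : V) : X.psi 1 v = v := by
  have : (charLin (1 : G →* Kˣ)).toLinearMap = Coalgebra.counit (R := K) := by
    ext g
    simp
  rw [psi, this]
  exact X.coact_counit v

lemma psi_mul (X : LeftModule K (MonoidAlgebra K G) V) (γ γ' : G →* Kˣ) (v : V) :
    X.psi (γ * γ') v = X.psi γ (X.psi γ' v) := by
  have h1 : (charLin (γ * γ')).toLinearMap = LinearMap.mul' K K ∘ₗ
      TensorProduct.map (charLin γ').toLinearMap (charLin γ).toLinearMap ∘ₗ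
        Coalgebra.comul (R := K) := by
    ext g
    simp [mul_comm]
  let F : MonoidAlgebra K G ⊗[K] (MonoidAlgebra K G ⊗[K] V) →ₗ[K] V :=
    (TensorProduct.lid K V).toLinearMap ∘ₗ TensorProduct.map (charLin γ').toLinearMap
      ((TensorProduct.lid K V).toLinearMap ∘ₗ (charLin γ).toLinearMap.rTensor V)
  have h2 := congrArg F (X.coact_coassoc v)
  have h3 : ∀ x : MonoidAlgebra K G ⊗[K] V, F (TensorProduct.assoc K _ _ V
      ((Coalgebra.comul (R := K) (A := MonoidAlgebra K G)).rTensor V x)) =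
      TensorProduct.lid K V ((charLin (γ * γ')).toLinearMap.rTensor V x) := by
    intro x
    rw [h1]
    induction x with
    | zero => simp
    | add x y hx hy => simp only [map_add, hx, hy]
    | tmul u v =>
      simp only [LinearMap.rTensor_tmul, LinearMap.comp_apply]
      induction Coalgebra.comul (R := K) u with
      | zero => simp
      | add x y hx hy => simp only [map_add, TensorProduct.add_tmul, hx, hy]
      | tmul p q => simp [F, smul_smul, mul_comm]
  have h4 : ∀ x : MonoidAlgebra K G ⊗[K] V, F (X.coact.lTensor _ x) =
      X.psi γ (TensorProduct.lid K V ((charLin γ').toLinearMap.rTensor V x)) := by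
    intro x
    induction x with
    | zero => simp
    | add x y hx hy => simp only [map_add, hx, hy]
    | tmul u v => simp [F, psi]
  rw [h3, h4] at h2
  exact h2

/-- The inertia group `T_v = {g | φ_g(v) = v}`. -/
def inertiaGroup (X : LeftModule K (MonoidAlgebra K G) V) (v : V) : Subgroup G where
  carrier := {g | X.phi g v = v}
  one_mem' := X.phi_one v
  mul_mem' := fun {g h} hg hh => by
    change X.phi (g * h) v = v
    rw [X.phi_mul, hh, hg]
  inv_mem' := fun {g} hg => by
    change X.phi g⁻¹ v = v
    conv_lhs => rw [← show X.phi g v = v from hg]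
    rw [← X.phi_mul, inv_mul_cancel, X.phi_one]

/-- The isotropy group `Q_v = {γ | ψ_γ(v) = v}`. -/
def isotropyGroup (X : LeftModule K (MonoidAlgebra K G) V) (v : V) : Subgroup (G →* Kˣ) where
  carrier := {γ | X.psi γ v = v}
  one_mem' := X.psi_one v
  mul_mem' := fun {g h} hg hh => by
    change X.psi (g * h) v = v
    rw [X.psi_mul, hh, hg]
  inv_mem' := fun {g} hg => by
    change X.psi g⁻¹ v = v
    conv_lhs => rw [← show X.psi g v = v from hg]
    rw [← X.psi_mul]
    exact (congrArg (fun γ => X.psi γ v) (inv_mul_cancel g)).trans (X.psi_one v)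

end LeftModule

/-- `Q^⊥ = {g ∈ G | γ(g) = 1 for all γ ∈ Q}` -/
def perp (Q : Subgroup (G →* Kˣ)) : Subgroup G :=
  ⨅ γ ∈ Q, γ.ker

lemma mem_perp (Q : Subgroup (G →* Kˣ)) (g : G) : g ∈ perp Q ↔ ∀ γ ∈ Q, γ g = 1 := by
  simp [perp, Subgroup.mem_iInf, MonoidHom.mem_ker]

namespace LeftModule

/-- The index group `Q_v^⊥ / (T_v ∩ Q_v^⊥)`. -/
abbrev IndexGroup (X : LeftModule K (MonoidAlgebra K G) V) (v : V) : Type _ :=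
  perp (X.isotropyGroup v) ⧸ (X.inertiaGroup v).subgroupOf (perp (X.isotropyGroup v))

/-- The index, i.e., the order of the index group. -/
def index (X : LeftModule K (MonoidAlgebra K G) V) (v : V) : ℕ :=
  Nat.card (X.IndexGroup v)

end LeftModule

end AbelianGroup

/-! ### Primitive idempotents, their characters, and the stability set -/

/-- A primitive idempotent: a nonzero idempotent that is not the sum of two nonzero orthogonal
idempotents. -/
structure IsPrimitiveIdempotent {A : Type*} [Ring A] (e : A) : Prop where
  isIdempotentElem : IsIdempotentElem e
  ne_zero : e ≠ 0
  eq_zero_or : ∀ f f' : A, IsIdempotentElem f → IsIdempotentElem f' → f * f' = 0 → f' * f = 0 →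
    f + f' = e → f = 0 ∨ f' = 0

/-- `η` is the character associated with the primitive idempotent `e`. -/
def IsCharacterOf {K A : Type*} [Field K] [Ring A] [Algebra K A] (e : A) (η : A →ₐ[K] K) : Prop :=
  η e = 1 ∧ ∀ e' : A, IsPrimitiveIdempotent e' → e' ≠ e → η e' = 0

namespace LeftHopfAlgebra

variable {K G A : Type*} [Field K] [CommGroup G] [Ring A] [Algebra K A] [Coalgebra K A]

/-- The stability set: the primitive idempotents `e'` with `T_e ⊆ T_{e'}` and `Q_e ⊆ Q_{e'}`. -/
def stabilitySet (X : LeftHopfAlgebra K (MonoidAlgebra K G) A) (e : A) : Set A :=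
  {e' | IsPrimitiveIdempotent e' ∧ X.inertiaGroup e ≤ X.inertiaGroup e' ∧
    X.isotropyGroup e ≤ X.isotropyGroup e'}

/-- The characters associated with the elements of the stability set, as elements of `A*`. -/
def stabilityCharacters (X : LeftHopfAlgebra K (MonoidAlgebra K G) A) (e : A) :
    Set (Dual K A) :=
  {χ | ∃ e' ∈ X.stabilitySet e, ∃ η : A →ₐ[K] K, IsCharacterOf e' η ∧ χ.toLin = η.toLinearMap}

end LeftHopfAlgebra

end YetterDrinfeld

end

/-!
# Stability sets of primitive idempotents span Hopf subalgebras of the dual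

For `a` in `A`, write `a_h` (`LeftModule.proj`) for the component of degree `h ∈ G`, so that
`δ(a) = ∑ h ⊗ a_h`. Multiplicativity of `Δ` reads `Δ(ab) = ∑ a₁ (h.b₁) ⊗ (a₂)_h b₂`.

*Finite dimension.* A semisimple commutative algebra with the character `ε` contains an integral `Λ`
with `ε(Λ) = 1`. The formula `∑ h.Λ₁ ⊗ a_h Λ₂ = S(a) Λ₁ ⊗ Λ₂` (`braidedMul_integral`) shows that the
right tensor legs of `Δ(Λ)` form an ideal. It is finite-dimensional and contains `1 = S(Λ₁) Λ₂`.

*Hopf subalgebra.* Now `A` is the algebra of functions on the finite set of its characters, and the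
primitive idempotents are the delta functions. The operators `φ_g` with `g ∈ T_e` and `ψ_γ` with
`γ ∈ Q_e` are algebra and coalgebra automorphisms `f` of `A` that commute with the action of `G` and
with the projections to the homogeneous components. The stability characters are the characters
fixed by all these `f`. Hence their span is the space of linear forms that vanish on the ideal
generated by all `f(a) - a` (`equalizingForms_eq_span`). In this description it is evident that the
space is stable under the action and the coaction and contains the unit. It is closed under products
because `(φψ)(f(a) b) = ∑ φ(f(a₁) h.b₁) ψ(f((a₂)_h) b₂)`. The coproduct is no problem since
characters are group-like, and for the same reason the antipode of a character is its inverse in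
`A*`, which lies in every finite-dimensional subalgebra that contains the character.

*Index one.* In this case `Q_e^⊥ ⊆ T_e`. If `φ` and `ψ` belong to the span, then `ψ` vanishes on the
components of degree outside `Q_e^⊥`, and `φ` is invariant under `Q_e^⊥`, whence
`φ(h.b) ψ(a_h) = φ(b) ψ(a_h)` for all `h` (`apply_proj_mul_apply_phi`). So the braiding is the flip on
the span, and the product of two stability characters is again a character. A finite cancellative
monoid is a group, and group-like elements are linearly independent.
-/

namespace YetterDrinfeld

/-! ### Primitive idempotents of finite-dimensional commutative semisimple algebras -/

section SplitSemisimple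

variable {K A : Type*} [Field K] [CommRing A] [Algebra K A]

/-- The characters of a commutative semisimple algebra separate its elements: every residue field
is `K`, and the intersection of the maximal ideals is zero. -/
lemma eq_zero_of_forall_algHom [IsAlgClosed K] [FiniteDimensional K A] [IsSemisimpleRing A]
    {a : A} (h : ∀ ω : A →ₐ[K] K, ω a = 0) : a = 0 := by
  have hJ : a ∈ Ring.jacobson A := by
    rw [← Ideal.jacobson_bot, Ideal.jacobson, Ideal.mem_sInf]
    rintro M ⟨-, hM⟩
    have hb := IsAlgClosed.algebraMap_bijective_of_isIntegral (k := K) (K := A ⧸ M)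
    let E : K ≃ₐ[K] A ⧸ M := AlgEquiv.ofBijective (Algebra.ofId K (A ⧸ M)) hb
    have h1 := h (E.symm.toAlgHom.comp (Ideal.Quotient.mkₐ K M))
    exact Ideal.Quotient.eq_zero_iff_mem.mp
      (E.symm.injective (h1.trans (map_zero E.symm).symm))
  rw [IsSemisimpleRing.jacobson_eq_bot] at hJ
  exact hJ

/-- For every character `ω` there is an element on which `ω` is one and all the other characters
vanish. -/
lemma exists_algHom_delta [FiniteDimensional K A] (ω : A →ₐ[K] K) :
    ∃ e : A, ω e = 1 ∧ ∀ ω' : A →ₐ[K] K, ω' ≠ ω → ω' e = 0 := by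
  classical
  have := Fintype.ofFinite (A →ₐ[K] K)
  have h1 : ∀ ω' : A →ₐ[K] K, ∃ a : A, ω a = 1 ∧ (ω' ≠ ω → ω' a = 0) := by
    intro ω'
    by_cases h : ω' = ω
    · exact ⟨1, map_one ω, fun h' => absurd h h'⟩
    · obtain ⟨a, ha⟩ := DFunLike.ne_iff.mp h
      refine ⟨(ω a - ω' a)⁻¹ • (a - algebraMap K A (ω' a)), ?_, fun _ => ?_⟩
      · rw [map_smul, map_sub, AlgHom.commutes, smul_eq_mul]
        exact inv_mul_cancel₀ (sub_ne_zero.mpr (Ne.symm ha))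
      · simp
  choose c hc hc' using h1
  refine ⟨∏ ω', c ω', ?_, fun ω' h => ?_⟩
  · rw [map_prod]
    exact Finset.prod_eq_one fun i _ => hc i
  · rw [map_prod]
    exact Finset.prod_eq_zero (Finset.mem_univ ω') (hc' ω' h)

/-- An element at which the character `ω` is one and all the other characters vanish. In a semisimple
algebra over an algebraically closed field it is unique, and it is a primitive idempotent. -/
noncomputable def charIdem [FiniteDimensional K A] (ω : A →ₐ[K] K) : A :=
  (exists_algHom_delta ω).choose

section FiniteDimensional

variable [FiniteDimensional K A]

@[simp] lemma apply_charIdem_self (ω : A →ₐ[K] K) : ω (charIdem ω) = 1 :=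
  (exists_algHom_delta ω).choose_spec.1

lemma apply_charIdem_of_ne {ω ω' : A →ₐ[K] K} (h : ω' ≠ ω) : ω' (charIdem ω) = 0 :=
  (exists_algHom_delta ω).choose_spec.2 ω' h

lemma eq_of_apply_charIdem_ne_zero {ω ω' : A →ₐ[K] K} (h : ω' (charIdem ω) ≠ 0) : ω' = ω := by
  by_contra h'
  exact h (apply_charIdem_of_ne h')

variable [IsAlgClosed K] [IsSemisimpleRing A]

lemma algHom_separates {a b : A} (h : ∀ ω : A →ₐ[K] K, ω a = ω b) : a = b :=
  sub_eq_zero.mp (eq_zero_of_forall_algHom (K := K) fun ω => by rw [map_sub, h, sub_self])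

lemma mul_charIdem (a : A) (ω : A →ₐ[K] K) : a * charIdem ω = ω a • charIdem ω := by
  refine algHom_separates (K := K) fun ω' => ?_
  by_cases h : ω' = ω
  · simp [h]
  · simp [apply_charIdem_of_ne h]

lemma isIdempotentElem_charIdem (ω : A →ₐ[K] K) : IsIdempotentElem (charIdem ω) := by
  rw [IsIdempotentElem, mul_charIdem, apply_charIdem_self, one_smul]

lemma sum_smul_charIdem [Fintype (A →ₐ[K] K)] (a : A) :
    ∑ ω : A →ₐ[K] K, ω a • charIdem ω = a := by
  refine algHom_separates (K := K) fun ω' => ?_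
  rw [map_sum, Finset.sum_eq_single ω' (fun ω _ h => ?_) (fun h => absurd (Finset.mem_univ _) h)]
  · simp
  · rw [map_smul, apply_charIdem_of_ne (Ne.symm h), smul_zero]

lemma isPrimitiveIdempotent_charIdem (ω : A →ₐ[K] K) : IsPrimitiveIdempotent (charIdem ω) where
  isIdempotentElem := isIdempotentElem_charIdem ω
  ne_zero h := by
    have := apply_charIdem_self ω
    rw [h, map_zero] at this
    exact zero_ne_one this
  eq_zero_or f f' hf hf' h h' hs := by
    have h1 : f = ω f • charIdem ω := by
      rw [← mul_charIdem, ← hs, mul_add, h, add_zero, hf.eq]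
    have h2 : f' = ω f' • charIdem ω := by
      rw [← mul_charIdem, ← hs, mul_add, h', zero_add, hf'.eq]
    have h3 : ω f * ω f' = 0 := by rw [← map_mul, h, map_zero]
    rcases mul_eq_zero.mp h3 with h4 | h4
    · left
      rw [h1, h4, zero_smul]
    · right
      rw [h2, h4, zero_smul]

variable (K) in
lemma exists_eq_charIdem {e : A} (he : IsPrimitiveIdempotent e) :
    ∃ ω : A →ₐ[K] K, e = charIdem ω := by
  obtain ⟨ω, hω⟩ : ∃ ω : A →ₐ[K] K, ω e ≠ 0 := by
    by_contra! h
    exact he.ne_zero (eq_zero_of_forall_algHom h)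
  have h1 : ω e = 1 := by
    have := congrArg ω he.isIdempotentElem.eq
    rw [map_mul] at this
    exact mul_right_cancel₀ hω (this.trans (one_mul _).symm)
  have h2 : e * charIdem ω = charIdem ω := by rw [mul_charIdem, h1, one_smul]
  have hi := isIdempotentElem_charIdem ω
  have h3 : e * charIdem ω * (e * (1 - charIdem ω)) = 0 := by
    rw [mul_mul_mul_comm, hi.mul_one_sub_self, mul_zero]
  refine ⟨ω, ?_⟩
  rcases he.eq_zero_or (e * charIdem ω) (e * (1 - charIdem ω)) (he.isIdempotentElem.mul hi)
      (he.isIdempotentElem.mul hi.one_sub) h3 (by rw [mul_comm, h3]) (by ring) with h4 | h4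
  · exact absurd (h2.symm.trans h4) (isPrimitiveIdempotent_charIdem ω).ne_zero
  · rw [mul_sub, mul_one, h2] at h4
    exact sub_eq_zero.mp h4

lemma isCharacterOf_charIdem_iff {ω η : A →ₐ[K] K} : IsCharacterOf (charIdem ω) η ↔ η = ω := by
  refine ⟨fun h => eq_of_apply_charIdem_ne_zero (by rw [h.1]; exact one_ne_zero), ?_⟩
  rintro rfl
  refine ⟨apply_charIdem_self η, fun e' he' hne => ?_⟩
  obtain ⟨ω', rfl⟩ := exists_eq_charIdem K he'
  exact apply_charIdem_of_ne fun h => hne (by rw [h])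

lemma existsUnique_isCharacterOf {e : A} (he : IsPrimitiveIdempotent e) :
    ∃! η : A →ₐ[K] K, IsCharacterOf e η := by
  obtain ⟨ω, rfl⟩ := exists_eq_charIdem K he
  exact ⟨ω, isCharacterOf_charIdem_iff.mpr rfl, fun _ h => isCharacterOf_charIdem_iff.mp h⟩

/-- A surjective algebra endomorphism permutes the primitive idempotents, dually to the
characters. -/
lemma map_charIdem_eq_iff {f : A →ₐ[K] A} (hf : Function.Surjective f) (ω : A →ₐ[K] K) :
    f (charIdem ω) = charIdem ω ↔ ω.comp f = ω := by
  constructor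
  · intro h
    refine eq_of_apply_charIdem_ne_zero ?_
    rw [AlgHom.comp_apply, h, apply_charIdem_self]
    exact one_ne_zero
  · intro h
    refine algHom_separates (K := K) fun ω' => ?_
    rw [← AlgHom.comp_apply]
    by_cases h' : ω' = ω
    · rw [h', h]
    · rw [apply_charIdem_of_ne h', apply_charIdem_of_ne]
      intro h2
      exact h' ((AlgHom.cancel_right hf).mp (h2.trans h.symm))

end FiniteDimensional

/-- A semisimple algebra with a character `ε` contains an integral `Λ` with `ε(Λ) = 1`. -/
lemma exists_integral [IsSemisimpleRing A] (ε : A →ₐ[K] K) :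
    ∃ Λ : A, ε Λ = 1 ∧ ∀ a, a * Λ = ε a • Λ := by
  obtain ⟨J, hJ⟩ := exists_isCompl (RingHom.ker ε)
  have h1 : (1 : A) ∈ RingHom.ker ε ⊔ J := by
    rw [hJ.sup_eq_top]
    trivial
  obtain ⟨k, hk, Λ, hΛ, h⟩ := Submodule.mem_sup.mp h1
  refine ⟨Λ, ?_, fun a => ?_⟩
  · have h2 := congrArg ε h
    rwa [map_add, map_one, (RingHom.mem_ker).mp hk, zero_add] at h2
  · have h2 : (a - algebraMap K A (ε a)) * Λ ∈ RingHom.ker ε ⊓ J := by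
      refine ⟨Ideal.mul_mem_right _ _ ?_, Ideal.mul_mem_left _ _ hΛ⟩
      rw [RingHom.mem_ker]
      simp
    rw [hJ.inf_eq_bot, Submodule.mem_bot, sub_mul, sub_eq_zero] at h2
    rw [h2, Algebra.smul_def]

end SplitSemisimple

/-! ### Homogeneous components over a group algebra -/

/-- The coefficient of `h` of an element of the group algebra. -/
noncomputable def coeffLin (K : Type*) {G : Type*} [Field K] (h : G) :
    MonoidAlgebra K G →ₗ[K] K :=
  Finsupp.lapply (R := K) h ∘ₗ (MonoidAlgebra.coeffLinearEquiv (R := K) (S := K)).toLinearMap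

lemma coeffLin_single_self {K G : Type*} [Field K] (h : G) (c : K) :
    coeffLin K h (MonoidAlgebra.single h c) = c := by
  simp [coeffLin]

lemma coeffLin_single_of_ne {K G : Type*} [Field K] {h k : G} (hk : k ≠ h) (c : K) :
    coeffLin K h (MonoidAlgebra.single k c) = 0 := by
  simp [coeffLin, hk]

namespace LeftModule

variable {K G V : Type*} [Field K] [CommGroup G] [AddCommGroup V] [Module K V]

/-- The projection to the homogeneous component of degree `h`, so that
`δ(v) = ∑ h, h ⊗ X.proj h v`. -/
noncomputable def proj (X : LeftModule K (MonoidAlgebra K G) V) (h : G) : V →ₗ[K] V :=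
  (TensorProduct.lid K V).toLinearMap ∘ₗ (coeffLin K h).rTensor V ∘ₗ X.coact

variable (X : LeftModule K (MonoidAlgebra K G) V)

lemma proj_apply (h : G) (v : V) :
    X.proj h v = TensorProduct.lid K V ((coeffLin K h).rTensor V (X.coact v)) := rfl

lemma coact_eq_sum [Fintype G] (v : V) :
    X.coact v = ∑ h, MonoidAlgebra.single h (1 : K) ⊗ₜ[K] X.proj h v := by
  have key : ∀ x : MonoidAlgebra K G ⊗[K] V, x = ∑ h, MonoidAlgebra.single h (1 : K) ⊗ₜ[K]
      (TensorProduct.lid K V).toLinearMap ((coeffLin K h).rTensor V x) := by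
    intro x
    induction x with
    | zero => simp
    | add x y hx hy => simp only [map_add, TensorProduct.tmul_add, Finset.sum_add_distrib, ← hx,
      ← hy]
    | tmul u v =>
      refine lin_single (f := (TensorProduct.mk K _ V).flip v)
        (f' := ∑ h, TensorProduct.mk K (MonoidAlgebra K G) V (MonoidAlgebra.single h (1 : K)) ∘ₗ
          (LinearMap.toSpanSingleton K V v ∘ₗ coeffLin K h)) (fun g => ?_) u |>.trans ?_
      · rw [LinearMap.sum_apply, Finset.sum_eq_single g]
        · simp [coeffLin_single_self]
        · intro h _ hh
          simp [coeffLin_single_of_ne (Ne.symm hh)]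
        · exact fun h => absurd (Finset.mem_univ g) h
      · simp
  exact key _

lemma psi_eq_sum [Fintype G] (γ : G →* Kˣ) (v : V) :
    X.psi γ v = ∑ h, (γ h : K) • X.proj h v := by
  simp [psi, coact_eq_sum]

lemma coact_proj [Finite G] (h : G) (v : V) :
    X.coact (X.proj h v) = MonoidAlgebra.single h (1 : K) ⊗ₜ[K] X.proj h v := by
  have := Fintype.ofFinite G
  have h1 := congrArg (fun x => TensorProduct.lid K _ ((coeffLin K h).rTensor _ x))
    (X.coact_coassoc v)
  simp only [X.coact_eq_sum v, map_sum, LinearMap.rTensor_tmul, LinearMap.lTensor_tmul,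
    MonoidAlgebra.comul_single, CommSemiring.comul_apply, TensorProduct.map_tmul,
    TensorProduct.assoc_tmul, TensorProduct.lid_tmul, MonoidAlgebra.lsingle_apply] at h1
  rw [Finset.sum_eq_single h, Finset.sum_eq_single h] at h1
  · simpa [coeffLin_single_self] using h1.symm
  · intro k _ hk
    rw [coeffLin_single_of_ne hk, zero_smul]
  · exact fun h' => absurd (Finset.mem_univ h) h'
  · intro k _ hk
    rw [coeffLin_single_of_ne hk, zero_smul]
  · exact fun h' => absurd (Finset.mem_univ h) h'

lemma proj_proj_self [Finite G] (h : G) (v : V) : X.proj h (X.proj h v) = X.proj h v := by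
  rw [X.proj_apply h (X.proj h v), coact_proj]
  simp [coeffLin_single_self]

lemma proj_proj_of_ne [Finite G] {h k : G} (hk : k ≠ h) (v : V) :
    X.proj h (X.proj k v) = 0 := by
  rw [X.proj_apply h (X.proj k v), coact_proj]
  simp [coeffLin_single_of_ne hk]

lemma sum_proj [Fintype G] (v : V) : ∑ h, X.proj h v = v := by
  have h1 := X.psi_eq_sum 1 v
  rw [X.psi_one] at h1
  simpa using h1.symm

lemma psi_proj [Finite G] (γ : G →* Kˣ) (h : G) (v : V) :
    X.psi γ (X.proj h v) = (γ h : K) • X.proj h v := by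
  simp [psi, coact_proj]

lemma proj_psi [Finite G] (γ : G →* Kˣ) (h : G) (v : V) :
    X.proj h (X.psi γ v) = X.psi γ (X.proj h v) := by
  have := Fintype.ofFinite G
  rw [psi_proj, psi_eq_sum, map_sum, Finset.sum_eq_single h]
  · rw [map_smul, proj_proj_self]
  · intro k _ hk
    rw [map_smul, X.proj_proj_of_ne hk, smul_zero]
  · exact fun h' => absurd (Finset.mem_univ h) h'

lemma coact_phi [Fintype G] (g : G) (v : V) :
    X.coact (X.phi g v) = ∑ h, MonoidAlgebra.single h (1 : K) ⊗ₜ[K] X.phi g (X.proj h v) := by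
  rw [phi, conj_left, X.coact_eq_sum v, map_sum]
  refine Finset.sum_congr rfl fun h _ => ?_
  rw [TensorProduct.map_tmul, leftConj_tmul]
  simp [MonoidAlgebra.single_mul_single]

lemma proj_phi [Finite G] (g h : G) (v : V) :
    X.proj h (X.phi g v) = X.phi g (X.proj h v) := by
  have := Fintype.ofFinite G
  rw [X.proj_apply h (X.phi g v), coact_phi]
  rw [map_sum, map_sum, Finset.sum_eq_single h]
  · simp [coeffLin_single_self]
  · intro k _ hk
    simp [coeffLin_single_of_ne hk]
  · exact fun h' => absurd (Finset.mem_univ h) h'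

lemma psi_phi [Finite G] (γ : G →* Kˣ) (g : G) (v : V) :
    X.psi γ (X.phi g v) = X.phi g (X.psi γ v) := by
  have := Fintype.ofFinite G
  simp [psi_eq_sum, proj_phi]

lemma phi_comm (g h : G) (v : V) : X.phi g (X.phi h v) = X.phi h (X.phi g v) := by
  rw [← X.phi_mul, mul_comm, X.phi_mul]

lemma perp_le_of_index_eq_one {v : V} (hv : X.index v = 1) :
    perp (X.isotropyGroup v) ≤ X.inertiaGroup v := by
  have := (Nat.card_eq_one_iff_unique.mp hv).1
  rw [QuotientGroup.subsingleton_iff, Subgroup.subgroupOf_eq_top] at this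
  exact this

end LeftModule

/-! ### The structure maps in terms of homogeneous components -/

namespace LeftHopfAlgebra

variable {K G A : Type*} [Field K] [CommGroup G] [Ring A] [Algebra K A] [Coalgebra K A]
  (X : LeftHopfAlgebra K (MonoidAlgebra K G) A)

lemma diagAct_single (g : G) :
    diagAct K X.act X.act (MonoidAlgebra.single g 1) = TensorProduct.map (X.phi g) (X.phi g) := by
  simp [diagAct, LeftModule.phi]

lemma coact_mul_eq_sum [Fintype G] (a b : A) : X.coact (a * b) =
    ∑ h, ∑ k, MonoidAlgebra.single (h * k) (1 : K) ⊗ₜ[K] (X.proj h a * X.proj k b) := by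
  rw [X.coact_mul_eq, leftCodiag_tmul, X.coact_eq_sum a, X.coact_eq_sum b]
  simp only [TensorProduct.sum_tmul, TensorProduct.tmul_sum, map_sum,
    TensorProduct.tensorTensorTensorComm_tmul, LinearMap.rTensor_tmul, LinearMap.lTensor_tmul,
    LinearMap.mul'_apply, MonoidAlgebra.single_mul_single, mul_one]
  exact Finset.sum_comm

/-- The action of a group element, as an algebra homomorphism. -/
noncomputable def phiHom (g : G) : A →ₐ[K] A :=
  AlgHom.ofLinearMap (X.phi g)
    (by simpa [LeftModule.phi] using X.act_one_eq (MonoidAlgebra.single g 1))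
    (fun a b => by
      have := X.act_mul_eq (MonoidAlgebra.single g 1) a b
      rwa [diagAct_single] at this)

@[simp] lemma phiHom_apply (g : G) (a : A) : X.phiHom g a = X.phi g a := rfl

/-- The operator associated with a character, as an algebra homomorphism. -/
noncomputable def psiHom [Finite G] (γ : G →* Kˣ) : A →ₐ[K] A :=
  AlgHom.ofLinearMap (X.psi γ)
    (by simp [LeftModule.psi, X.coact_one_eq, MonoidAlgebra.one_def])
    (fun a b => by
      have := Fintype.ofFinite G
      conv_lhs => rw [LeftModule.psi, LinearMap.comp_apply, LinearMap.comp_apply, coact_mul_eq_sum]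
      simp only [X.psi_eq_sum, Finset.sum_mul_sum, smul_mul_smul_comm]
      simp)

@[simp] lemma psiHom_apply [Finite G] (γ : G →* Kˣ) (a : A) : X.psiHom γ a = X.psi γ a := rfl

lemma proj_mul [Fintype G] (h : G) (a b : A) :
    X.proj h (a * b) = ∑ k, X.proj k a * X.proj (k⁻¹ * h) b := by
  rw [X.proj_apply h (a * b), coact_mul_eq_sum]
  simp only [map_sum, LinearMap.rTensor_tmul, TensorProduct.lid_tmul]
  refine Finset.sum_congr rfl fun k _ => ?_
  rw [Finset.sum_eq_single (k⁻¹ * h)]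
  · rw [mul_inv_cancel_left, coeffLin_single_self, one_smul]
  · intro l _ hl
    rw [coeffLin_single_of_ne, zero_smul]
    rintro rfl
    simp at hl
  · exact fun h' => absurd (Finset.mem_univ _) h'

lemma comul_phi (g : G) (a : A) : Coalgebra.comul (R := K) (X.phi g a) =
    TensorProduct.map (X.phi g) (X.phi g) (Coalgebra.comul a) := by
  rw [← diagAct_single]
  exact X.comul_act _ a

lemma counit_phi (g : G) (a : A) :
    Coalgebra.counit (R := K) (X.phi g a) = Coalgebra.counit (R := K) a := by
  simpa [LeftModule.phi] using X.counit_act (MonoidAlgebra.single g 1) a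

lemma comul_psi [Finite G] (γ : G →* Kˣ) (a : A) : Coalgebra.comul (R := K) (X.psi γ a) =
    TensorProduct.map (X.psi γ) (X.psi γ) (Coalgebra.comul a) := by
  have := Fintype.ofFinite G
  have h1 := congrArg (fun x => TensorProduct.lid K _ ((charLin γ).toLinearMap.rTensor _ x))
    (X.comul_coact a)
  have key : ∀ x : A ⊗[K] A, TensorProduct.lid K _ ((charLin γ).toLinearMap.rTensor _
      (leftCodiag K X.coact X.coact x)) = TensorProduct.map (X.psi γ) (X.psi γ) x := by
    intro x
    induction x with
    | zero => simp
    | add x y hx hy => simp only [map_add, hx, hy]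
    | tmul u v =>
      rw [leftCodiag_tmul, X.coact_eq_sum, X.coact_eq_sum, TensorProduct.map_tmul, X.psi_eq_sum,
        X.psi_eq_sum]
      simp only [TensorProduct.sum_tmul, TensorProduct.tmul_sum, map_sum,
        TensorProduct.tensorTensorTensorComm_tmul, LinearMap.rTensor_tmul, LinearMap.mul'_apply,
        MonoidAlgebra.single_mul_single, TensorProduct.smul_tmul_smul]
      simp
  simp only [key] at h1
  rw [← h1, X.psi_eq_sum, X.coact_eq_sum]
  simp

lemma counit_psi [Finite G] (γ : G →* Kˣ) (a : A) :
    Coalgebra.counit (R := K) (X.psi γ a) = Coalgebra.counit (R := K) a := by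
  have := Fintype.ofFinite G
  have h1 := congrArg (fun x => TensorProduct.lid K _ ((charLin γ).toLinearMap.rTensor _ x))
    (X.counit_coact a)
  rw [X.coact_eq_sum] at h1
  rw [X.psi_eq_sum]
  simpa [MonoidAlgebra.one_def] using h1

/-- The braided product on `A ⊗ A` is `(a ⊗ a') (b ⊗ b') = ∑ h, a (h.b) ⊗ a'_h b'`, where `a'_h` is
the homogeneous component of degree `h`. -/
lemma braidedMul_tmul [Fintype G] (a a' b b' : A) :
    braidedMul K (leftBraid K X.coact X.act) ((a ⊗ₜ[K] a') ⊗ₜ[K] (b ⊗ₜ[K] b')) =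
      ∑ h, (a * X.phi h b) ⊗ₜ[K] (X.proj h a' * b') := by
  simp [braidedMul, leftBraid, X.coact_eq_sum a', TensorProduct.sum_tmul, TensorProduct.tmul_sum,
    LeftModule.phi]

/-- The convolution product on products of elements of `A`, from the multiplicativity of `Δ`. -/
lemma mul_apply_mul (φ ψ : Dual K A) (a b : A) : (φ * ψ) (a * b) =
    LinearMap.mul' K K (TensorProduct.map φ.toLin ψ.toLin
      (braidedMul K (leftBraid K X.coact X.act) (Coalgebra.comul a ⊗ₜ Coalgebra.comul b))) := by
  rw [dual_mul_apply, X.comul_mul]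

end LeftHopfAlgebra

/-! ### Semisimple Yetter-Drinfel'd Hopf algebras are finite-dimensional -/

section Legs

variable {K A : Type*} [Field K] [AddCommGroup A] [Module K A]

/-- The map `f ↦ (f ⊗ id)(y)`, whose range is the space of right tensor legs of `y`. -/
noncomputable def rightLeg (y : A ⊗[K] A) : (A →ₗ[K] K) →ₗ[K] A :=
  (TensorProduct.lid K A).toLinearMap ∘ₗ LinearMap.applyₗ y ∘ₗ LinearMap.rTensorHom A

lemma rightLeg_apply (y : A ⊗[K] A) (f : A →ₗ[K] K) :
    rightLeg y f = TensorProduct.lid K A (f.rTensor A y) := rfl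

lemma rightLeg_add (x y : A ⊗[K] A) (f : A →ₗ[K] K) :
    rightLeg (x + y) f = rightLeg x f + rightLeg y f := by
  simp [rightLeg_apply]

lemma rightLeg_map (u v : A →ₗ[K] A) (y : A ⊗[K] A) (f : A →ₗ[K] K) :
    rightLeg (TensorProduct.map u v y) f = v (rightLeg y (f ∘ₗ u)) := by
  induction y with
  | zero => simp [rightLeg_apply]
  | tmul a b => simp [rightLeg_apply]
  | add x y hx hy => rw [map_add, rightLeg_add, hx, hy, rightLeg_add, map_add]

lemma finiteDimensional_range_rightLeg (y : A ⊗[K] A) :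
    FiniteDimensional K (LinearMap.range (rightLeg y)) := by
  induction y with
  | zero =>
    have : rightLeg (0 : A ⊗[K] A) = 0 := LinearMap.ext fun f => by simp [rightLeg_apply]
    rw [this, LinearMap.range_zero]
    infer_instance
  | tmul a b =>
    refine Submodule.finiteDimensional_of_le (S₂ := K ∙ b) ?_
    rintro _ ⟨f, rfl⟩
    exact Submodule.mem_span_singleton.mpr ⟨f a, by simp [rightLeg_apply]⟩
  | add x y hx hy =>
    refine Submodule.finiteDimensional_of_le
      (S₂ := LinearMap.range (rightLeg x) ⊔ LinearMap.range (rightLeg y)) ?_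
    rintro _ ⟨f, rfl⟩
    rw [rightLeg_add]
    exact Submodule.add_mem_sup ⟨f, rfl⟩ ⟨f, rfl⟩

lemma exists_eq_sum_tmul_rightLeg (y : A ⊗[K] A) :
    ∃ c : A →₀ A, (∀ a, c a ∈ LinearMap.range (rightLeg y)) ∧ c.sum (fun a b => a ⊗ₜ[K] b) = y := by
  classical
  let β := Module.Basis.ofVectorSpace K A
  obtain ⟨c, hc⟩ := TensorProduct.eq_repr_basis_left β y
  have h1 : ∀ i, rightLeg y (β.coord i) = c i := by
    intro i
    rw [← hc, rightLeg_apply, Finsupp.sum, map_sum, map_sum, Finset.sum_eq_single i]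
    · simp
    · intro j _ hj
      simp [Finsupp.single_eq_of_ne (Ne.symm hj)]
    · intro h
      simp [Finsupp.notMem_support_iff.mp h]
  refine ⟨c.embDomain ⟨β, β.injective⟩, fun a => ?_, ?_⟩
  · by_cases ha : a ∈ Set.range β
    · obtain ⟨i, rfl⟩ := ha
      have := Finsupp.embDomain_apply_self ⟨β, β.injective⟩ c i
      exact ⟨β.coord i, (h1 i).trans this.symm⟩
    · rw [Finsupp.embDomain_of_notMem_range _ _ _ ha]
      exact zero_mem _
  · rw [Finsupp.sum_embDomain]
    exact hc

end Legs

namespace LeftHopfAlgebra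

variable {K G A : Type*} [Field K] [CommGroup G] [Finite G] [CommRing A] [Algebra K A]
  [Coalgebra K A] (X : LeftHopfAlgebra K (MonoidAlgebra K G) A)

lemma braidedMul_tmul_left (a b : A) (y : A ⊗[K] A) :
    braidedMul K (leftBraid K X.coact X.act) ((a ⊗ₜ[K] b) ⊗ₜ[K] y) =
      (a ⊗ₜ[K] 1) * braidedMul K (leftBraid K X.coact X.act) ((1 ⊗ₜ[K] b) ⊗ₜ[K] y) := by
  have := Fintype.ofFinite G
  induction y with
  | zero => simp
  | add x y hx hy => rw [TensorProduct.tmul_add, map_add, hx, hy, TensorProduct.tmul_add, map_add,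
      mul_add]
  | tmul c d => simp [braidedMul_tmul, Finset.mul_sum]

lemma braidedMul_one_tmul_proj (h : G) (a : A) (y : A ⊗[K] A) :
    braidedMul K (leftBraid K X.coact X.act) ((1 ⊗ₜ[K] X.proj h a) ⊗ₜ[K] y) =
      TensorProduct.map (X.phi h) (LinearMap.mulLeft K (X.proj h a)) y := by
  have := Fintype.ofFinite G
  induction y with
  | zero => simp
  | add x y hx hy => rw [TensorProduct.tmul_add, map_add, hx, hy, map_add]
  | tmul c d =>
    rw [braidedMul_tmul, Finset.sum_eq_single h]
    · simp [X.proj_proj_self]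
    · intro k _ hk
      simp [X.proj_proj_of_ne (Ne.symm hk)]
    · exact fun h' => absurd (Finset.mem_univ h) h'

/-- For an integral `Λ`, a factor `a` on the right leg of `Δ(Λ)` moves to a factor `S(a)` on the
left leg: `∑ h, h.Λ₁ ⊗ a_h Λ₂ = S(a) Λ₁ ⊗ Λ₂`. The left-hand side is `S * id * F` for the
convolution product of linear maps from `A` to `A ⊗ A`, where `F(b) = (1 ⊗ b) Δ(Λ)` and
`(id * F)(a) = Δ(a) Δ(Λ) = ε(a) Δ(Λ)`. -/
lemma braidedMul_integral {Λ : A} (hΛ : ∀ a, a * Λ = Coalgebra.counit (R := K) a • Λ) (a : A) :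
    braidedMul K (leftBraid K X.coact X.act) ((1 ⊗ₜ[K] a) ⊗ₜ[K] Coalgebra.comul Λ) =
      (X.antipode a ⊗ₜ[K] 1) * Coalgebra.comul Λ := by
  set y : A ⊗[K] A := Coalgebra.comul Λ with hy
  let ι : A →ₗ[K] A ⊗[K] A :=
    (Algebra.TensorProduct.includeLeft (R := K) (S := K) (A := A) (B := A)).toLinearMap
  have hι : ∀ a b, ι (a * b) = ι a * ι b := fun a b =>
    map_mul (Algebra.TensorProduct.includeLeft (R := K) (S := K) (A := A) (B := A)) a b
  let F : A →ₗ[K] A ⊗[K] A := braidedMul K (leftBraid K X.coact X.act) ∘ₗ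
    (TensorProduct.mk K (A ⊗[K] A) (A ⊗[K] A)).flip y ∘ₗ TensorProduct.mk K A A 1
  let c : A →ₗ[K] A ⊗[K] A := LinearMap.toSpanSingleton K _ y ∘ₗ Coalgebra.counit
  have h1 : WithConv.toConv (ι ∘ₗ X.antipode) * WithConv.toConv ι = 1 := by
    refine WithConv.ofConv_injective (LinearMap.ext fun a => ?_)
    have key : ∀ x : A ⊗[K] A, LinearMap.mul' K _ (TensorProduct.map (ι ∘ₗ X.antipode) ι x) =
        ι (LinearMap.mul' K A (X.antipode.rTensor A x)) := by
      intro x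
      induction x with
      | zero => simp
      | add x y hx hy => simp only [map_add, hx, hy]
      | tmul u v => simp [hι]
    refine (key (Coalgebra.comul a)).trans ?_
    rw [X.antipode_left]
    exact AlgHom.commutes
      (Algebra.TensorProduct.includeLeft (R := K) (S := K) (A := A) (B := A)) _
  have h2 : WithConv.toConv ι * WithConv.toConv F = WithConv.toConv c := by
    refine WithConv.ofConv_injective (LinearMap.ext fun a => ?_)
    have key : ∀ x : A ⊗[K] A, LinearMap.mul' K _ (TensorProduct.map ι F x) =
        braidedMul K (leftBraid K X.coact X.act) (x ⊗ₜ[K] y) := by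
      intro x
      induction x with
      | zero => simp
      | add x y hx hy => simp only [map_add, TensorProduct.add_tmul, hx, hy]
      | tmul u v =>
        rw [braidedMul_tmul_left]
        rfl
    refine (key (Coalgebra.comul a)).trans ?_
    rw [hy, ← X.comul_mul, hΛ, map_smul]
    rfl
  have h3 : WithConv.toConv F = WithConv.toConv (ι ∘ₗ X.antipode) * WithConv.toConv c := by
    rw [← h2, ← mul_assoc, h1, one_mul]
  have key : ∀ x : A ⊗[K] A, LinearMap.mul' K _ (TensorProduct.map (ι ∘ₗ X.antipode) c x) =
      ι (X.antipode (TensorProduct.rid K A ((Coalgebra.counit (R := K)).lTensor A x))) * y := by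
    intro x
    induction x with
    | zero => simp
    | add x y hx hy => simp only [map_add, add_mul, hx, hy]
    | tmul u v => simp [c]
  have h4 := LinearMap.congr_fun (congrArg WithConv.ofConv h3) a
  refine h4.trans ((key (Coalgebra.comul a)).trans ?_)
  rw [Coalgebra.lTensor_counit_comul]
  simp [ι]

/-- The right tensor legs of `Δ(Λ)`, for an integral `Λ`, form an ideal. -/
lemma mul_mem_range_rightLeg (X : LeftHopfAlgebra K (MonoidAlgebra K G) A) {Λ : A} (hΛ : ∀ a, a * Λ = Coalgebra.counit (R := K) a • Λ)
    (a : A) {w : A} (hw : w ∈ LinearMap.range (rightLeg (K := K) (Coalgebra.comul Λ))) :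
    a * w ∈ LinearMap.range (rightLeg (K := K) (Coalgebra.comul Λ)) := by
  have := Fintype.ofFinite G
  obtain ⟨f, rfl⟩ := hw
  rw [← X.sum_proj a, Finset.sum_mul]
  refine sum_mem fun h _ => ⟨f ∘ₗ X.phi h⁻¹ ∘ₗ LinearMap.mulLeft K (X.antipode (X.proj h a)), ?_⟩
  have h1 := X.braidedMul_integral hΛ (X.proj h a)
  rw [braidedMul_one_tmul_proj] at h1
  have h2 : (X.antipode (X.proj h a) ⊗ₜ[K] 1) * Coalgebra.comul (R := K) Λ = TensorProduct.map
      (LinearMap.mulLeft K (X.antipode (X.proj h a))) LinearMap.id (Coalgebra.comul Λ) := by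
    induction Coalgebra.comul (R := K) Λ with
    | zero => simp
    | add x y hx hy => rw [mul_add, hx, hy, map_add]
    | tmul u v => simp
  have h3 := congrArg (fun y => rightLeg y (f ∘ₗ X.phi h⁻¹)) (h1.trans h2)
  simp only [rightLeg_map] at h3
  have h4 : (f ∘ₗ X.phi h⁻¹) ∘ₗ X.phi h = f := by
    ext b
    simp [← X.phi_mul, X.phi_one]
  rw [h4] at h3
  exact h3.symm

/-- Sweedler's argument: for an integral `Λ` with `ε(Λ) = 1`, the right tensor legs of `Δ(Λ)` form a
finite-dimensional ideal that contains `1 = S(Λ₁) Λ₂`. -/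
theorem finiteDimensional [IsSemisimpleRing A] (X : LeftHopfAlgebra K (MonoidAlgebra K G) A) :
    FiniteDimensional K A := by
  let ε : A →ₐ[K] K := AlgHom.ofLinearMap Coalgebra.counit X.counit_one X.counit_mul
  obtain ⟨Λ, hΛ1, hΛ⟩ := exists_integral ε
  have h1 : (1 : A) ∈ LinearMap.range (rightLeg (K := K) (Coalgebra.comul Λ)) := by
    obtain ⟨c, hc, hc'⟩ := exists_eq_sum_tmul_rightLeg (K := K) (Coalgebra.comul Λ)
    have h2 := X.antipode_left Λ
    rw [← hc', show Coalgebra.counit (R := K) Λ = 1 from hΛ1, map_one, Finsupp.sum, map_sum,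
      map_sum] at h2
    rw [← h2]
    exact sum_mem fun a _ => X.mul_mem_range_rightLeg hΛ _ (hc a)
  have h3 : LinearMap.range (rightLeg (K := K) (Coalgebra.comul Λ)) = ⊤ := by
    rw [eq_top_iff]
    intro a _
    rw [← mul_one a]
    exact X.mul_mem_range_rightLeg hΛ a h1
  have h4 := finiteDimensional_range_rightLeg (K := K) (Coalgebra.comul Λ)
  rw [h3] at h4
  exact Module.finite_def.mpr (Submodule.fg_iff_finiteDimensional _ |>.mpr h4)

end LeftHopfAlgebra

/-! ### Characters as elements of the dual -/

section CharacterInDual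

variable {K A : Type*} [Field K] [CommRing A] [Algebra K A] [Coalgebra K A]

/-- A character of `A`, as an element of `A*`. -/
noncomputable def charDual (ω : A →ₐ[K] K) : Dual K A :=
  Dual.toLin.symm ω.toLinearMap

@[simp] lemma charDual_apply (ω : A →ₐ[K] K) (a : A) : charDual ω a = ω a := rfl

lemma charDual_injective : Function.Injective (charDual (K := K) (A := A)) := fun ω ω' h =>
  AlgHom.ext fun a => by rw [← charDual_apply, h, charDual_apply]

variable [FiniteDimensional K A]

lemma comul_charDual (ω : A →ₐ[K] K) :
    Coalgebra.comul (R := K) (charDual ω) = charDual ω ⊗ₜ charDual ω := by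
  refine pair_pair _ _ fun a b => ?_
  rw [pair_comul]
  simp

lemma isGroupLikeElem_charDual (ω : A →ₐ[K] K) : IsGroupLikeElem K (charDual ω) where
  counit_eq_one := by simp
  comul_eq_tmul_self := comul_charDual ω

end CharacterInDual

/-! ### Linear forms that do not distinguish `f(a)` from `a` -/

section EqualizingForms

variable {K A : Type*} [Field K] [CommRing A] [Algebra K A] [Coalgebra K A]

/-- The linear forms that vanish on the ideal generated by all `f(a) - a` with `f ∈ F`. -/
def equalizingForms (F : Set (A →ₐ[K] A)) : Submodule K (Dual K A) where
  carrier := {φ | ∀ f ∈ F, ∀ a b, φ (f a * b) = φ (a * b)}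
  add_mem' {φ ψ} hφ hψ f hf a b := by
    change φ (f a * b) + ψ (f a * b) = φ (a * b) + ψ (a * b)
    rw [hφ f hf, hψ f hf]
  zero_mem' _ _ _ _ := rfl
  smul_mem' c φ hφ f hf a b := by
    rw [dual_smul_apply, hφ f hf, dual_smul_apply]

lemma charDual_mem_equalizingForms {F : Set (A →ₐ[K] A)} {ω : A →ₐ[K] K} :
    charDual ω ∈ equalizingForms F ↔ ∀ f ∈ F, ω.comp f = ω := by
  constructor
  · intro h f hf
    ext a
    simpa using h f hf a 1
  · intro h f hf a b
    rw [charDual_apply, charDual_apply, map_mul, map_mul, ← AlgHom.comp_apply, h f hf]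

/-- As `A` is the algebra of functions on its characters, the linear forms that vanish on the ideal
generated by all `f(a) - a` are spanned by the characters fixed by all `f`. -/
lemma equalizingForms_eq_span [IsAlgClosed K] [FiniteDimensional K A] [IsSemisimpleRing A]
    (F : Set (A →ₐ[K] A)) :
    equalizingForms F = Submodule.span K (charDual '' {ω | ∀ f ∈ F, ω.comp f = ω}) := by
  apply le_antisymm
  · intro φ hφ
    have := Fintype.ofFinite (A →ₐ[K] K)
    have h1 : φ = ∑ ω : A →ₐ[K] K, φ (charIdem ω) • charDual ω := by
      apply Dual.toLin.injective
      rw [map_sum]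
      ext a
      rw [LinearMap.sum_apply]
      conv_lhs => rw [← sum_smul_charIdem (K := K) a, map_sum]
      refine Finset.sum_congr rfl fun ω _ => ?_
      rw [map_smul, map_smul, LinearMap.smul_apply, charDual_apply, smul_eq_mul, smul_eq_mul,
        mul_comm]
    rw [h1]
    refine sum_mem fun ω _ => ?_
    by_cases h2 : φ (charIdem ω) = 0
    · rw [h2, zero_smul]
      exact zero_mem _
    · refine Submodule.smul_mem _ _ (Submodule.subset_span ⟨ω, fun f hf => ?_, rfl⟩)
      ext a
      have h3 := hφ f hf a (charIdem ω)
      rw [mul_charIdem, mul_charIdem, map_smul, map_smul] at h3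
      exact mul_right_cancel₀ h2 h3
  · rw [Submodule.span_le]
    rintro _ ⟨ω, hω, rfl⟩
    exact charDual_mem_equalizingForms.mpr hω

end EqualizingForms

namespace LeftHopfAlgebra

section DualStructure

variable {K G A : Type*} [Field K] [CommGroup G] [CommRing A] [Algebra K A]
  [Coalgebra K A] [FiniteDimensional K A] (X : LeftHopfAlgebra K (MonoidAlgebra K G) A)

/-- The antipode sends a character to its convolution inverse. -/
lemma charDual_mul_antipode (ω : A →ₐ[K] K) : charDual ω * X.dual.antipode (charDual ω) = 1 := by
  have := X.dual.antipode_right (charDual ω)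
  rw [comul_charDual] at this
  simpa using this

lemma antipode_mul_charDual (ω : A →ₐ[K] K) : X.dual.antipode (charDual ω) * charDual ω = 1 := by
  have := X.dual.antipode_left (charDual ω)
  rw [comul_charDual] at this
  simpa using this

lemma dualCoact_eq_sum [Fintype G] (φ : Dual K A) :
    X.dualCoact φ = ∑ h, transpose (X.proj h) φ ⊗ₜ[K] MonoidAlgebra.single h (1 : K) := by
  refine pair_ext fun a => ?_
  rw [pair_dualCoact, X.coact_eq_sum]
  simp

end DualStructure

/-! ### The operators that fix a primitive idempotent -/

variable {K G A : Type*} [Field K] [CommGroup G] [Finite G] [CommRing A] [Algebra K A]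
  [Coalgebra K A] (X : LeftHopfAlgebra K (MonoidAlgebra K G) A)

/-- The operators `φ_g` with `g ∈ T_e` and `ψ_γ` with `γ ∈ Q_e`. -/
def stabilizers (e : A) : Set (A →ₐ[K] A) :=
  X.phiHom '' X.inertiaGroup e ∪ X.psiHom '' X.isotropyGroup e

lemma surjective_of_mem_stabilizers {e : A} {f : A →ₐ[K] A} (hf : f ∈ X.stabilizers e) :
    Function.Surjective f := by
  rcases hf with ⟨g, -, rfl⟩ | ⟨γ, -, rfl⟩
  · exact fun a => ⟨X.phi g⁻¹ a, by rw [phiHom_apply, ← X.phi_mul, mul_inv_cancel, X.phi_one]⟩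
  · refine fun a => ⟨X.psi γ⁻¹ a, ?_⟩
    rw [psiHom_apply, ← X.psi_mul]
    exact (congrArg (fun γ => X.psi γ a) (mul_inv_cancel γ)).trans (X.psi_one a)

lemma comul_of_mem_stabilizers {e : A} {f : A →ₐ[K] A} (hf : f ∈ X.stabilizers e) (a : A) :
    Coalgebra.comul (R := K) (f a) =
      TensorProduct.map f.toLinearMap f.toLinearMap (Coalgebra.comul a) := by
  rcases hf with ⟨g, -, rfl⟩ | ⟨γ, -, rfl⟩
  · exact X.comul_phi g a
  · exact X.comul_psi γ a

lemma counit_of_mem_stabilizers {e : A} {f : A →ₐ[K] A} (hf : f ∈ X.stabilizers e) (a : A) :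
    Coalgebra.counit (R := K) (f a) = Coalgebra.counit (R := K) a := by
  rcases hf with ⟨g, -, rfl⟩ | ⟨γ, -, rfl⟩
  · exact X.counit_phi g a
  · exact X.counit_psi γ a

lemma phi_of_mem_stabilizers {e : A} {f : A →ₐ[K] A} (hf : f ∈ X.stabilizers e) (h : G) (a : A) :
    X.phi h (f a) = f (X.phi h a) := by
  rcases hf with ⟨g, -, rfl⟩ | ⟨γ, -, rfl⟩
  · exact X.phi_comm h g a
  · exact (X.psi_phi γ h a).symm

lemma proj_of_mem_stabilizers {e : A} {f : A →ₐ[K] A} (hf : f ∈ X.stabilizers e) (h : G) (a : A) :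
    X.proj h (f a) = f (X.proj h a) := by
  rcases hf with ⟨g, -, rfl⟩ | ⟨γ, -, rfl⟩
  · exact X.proj_phi g h a
  · exact X.proj_psi γ h a

section

variable [IsAlgClosed K] [FiniteDimensional K A] [IsSemisimpleRing A]

lemma charIdem_mem_stabilitySet_iff (e : A) (ω : A →ₐ[K] K) :
    charIdem ω ∈ X.stabilitySet e ↔ ∀ f ∈ X.stabilizers e, ω.comp f = ω := by
  have h1 : (∀ f ∈ X.stabilizers e, ω.comp f = ω) ↔
      ∀ f ∈ X.stabilizers e, f (charIdem ω) = charIdem ω :=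
    forall₂_congr fun f hf => (map_charIdem_eq_iff (X.surjective_of_mem_stabilizers hf) ω).symm
  rw [h1]
  constructor
  · rintro ⟨-, hT, hQ⟩ f (⟨g, hg, rfl⟩ | ⟨γ, hγ, rfl⟩)
    · exact hT hg
    · exact hQ hγ
  · exact fun h => ⟨isPrimitiveIdempotent_charIdem ω, fun g hg => h _ (Or.inl ⟨g, hg, rfl⟩),
      fun γ hγ => h _ (Or.inr ⟨γ, hγ, rfl⟩)⟩

lemma stabilityCharacters_eq (e : A) : X.stabilityCharacters e =
    charDual '' {ω | ∀ f ∈ X.stabilizers e, ω.comp f = ω} := by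
  ext χ
  constructor
  · rintro ⟨e', he', η, hη, hχ⟩
    obtain ⟨ω, rfl⟩ := exists_eq_charIdem K he'.1
    obtain rfl := isCharacterOf_charIdem_iff.mp hη
    exact ⟨η, (X.charIdem_mem_stabilitySet_iff e η).mp he', Dual.toLin.injective hχ.symm⟩
  · rintro ⟨ω, hω, rfl⟩
    exact ⟨charIdem ω, (X.charIdem_mem_stabilitySet_iff e ω).mpr hω, ω,
      isCharacterOf_charIdem_iff.mpr rfl, rfl⟩

lemma charDual_mem_stabilityCharacters_iff (e : A) (ω : A →ₐ[K] K) :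
    charDual ω ∈ X.stabilityCharacters e ↔ charDual ω ∈ equalizingForms (X.stabilizers e) := by
  rw [stabilityCharacters_eq, charDual_mem_equalizingForms, charDual_injective.mem_set_image]
  rfl

lemma span_stabilityCharacters (e : A) :
    Submodule.span K (X.stabilityCharacters e) = equalizingForms (X.stabilizers e) := by
  rw [stabilityCharacters_eq, equalizingForms_eq_span]

end

/-! ### The span of the stability characters is a Hopf subalgebra -/

lemma one_mem_equalizingForms (e : A) : 1 ∈ equalizingForms (X.stabilizers e) := by
  intro f hf a b
  rw [dual_one_apply, dual_one_apply, X.counit_mul, X.counit_mul, X.counit_of_mem_stabilizers hf]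

/-- The product of two forms `φ` and `ψ` on `f(a) b` is
`∑ h, φ(f(a₁) h.b₁) ψ(f(a₂)_h b₂)`, where `f` can be omitted in both factors. -/
lemma mul_mem_equalizingForms {e : A} {φ ψ : Dual K A}
    (hφ : φ ∈ equalizingForms (X.stabilizers e)) (hψ : ψ ∈ equalizingForms (X.stabilizers e)) :
    φ * ψ ∈ equalizingForms (X.stabilizers e) := by
  have := Fintype.ofFinite G
  intro f hf a b
  rw [X.mul_apply_mul, X.mul_apply_mul, X.comul_of_mem_stabilizers hf]
  induction Coalgebra.comul (R := K) a with
  | zero => simp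
  | add x y hx hy => simp only [map_add, TensorProduct.add_tmul, hx, hy]
  | tmul u v =>
    induction Coalgebra.comul (R := K) b with
    | zero => simp
    | add x y hx hy => simp only [map_add, TensorProduct.tmul_add, hx, hy]
    | tmul u' v' =>
      rw [TensorProduct.map_tmul, braidedMul_tmul, braidedMul_tmul]
      simp only [map_sum, TensorProduct.map_tmul, LinearMap.mul'_apply]
      refine Finset.sum_congr rfl fun h _ => ?_
      rw [AlgHom.toLinearMap_apply, AlgHom.toLinearMap_apply, X.proj_of_mem_stabilizers hf,
        hφ f hf, hψ f hf]

lemma transpose_phi_mem_equalizingForms {e : A} {φ : Dual K A}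
    (hφ : φ ∈ equalizingForms (X.stabilizers e)) (g : G) :
    transpose (X.phi g) φ ∈ equalizingForms (X.stabilizers e) := by
  intro f hf a b
  have h1 : ∀ c, X.phi g (c * b) = X.phi g c * X.phi g b := fun c => map_mul (X.phiHom g) c b
  rw [transpose_apply, transpose_apply, h1, h1, X.phi_of_mem_stabilizers hf, hφ f hf]

lemma transpose_proj_mem_equalizingForms {e : A} {φ : Dual K A}
    (hφ : φ ∈ equalizingForms (X.stabilizers e)) (h : G) :
    transpose (X.proj h) φ ∈ equalizingForms (X.stabilizers e) := by
  have := Fintype.ofFinite G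
  intro f hf a b
  rw [transpose_apply, transpose_apply, X.proj_mul, X.proj_mul, map_sum, map_sum]
  refine Finset.sum_congr rfl fun k _ => ?_
  rw [X.proj_of_mem_stabilizers hf, hφ f hf]

section

variable [FiniteDimensional K A]

/-- The inverse of a character lies in every finite-dimensional subalgebra that contains it. -/
lemma antipode_charDual_mem {e : A} {ω : A →ₐ[K] K}
    (hω : charDual ω ∈ equalizingForms (X.stabilizers e)) :
    X.dual.antipode (charDual ω) ∈ equalizingForms (X.stabilizers e) := by
  have : FiniteDimensional K (Dual K A) := Module.Finite.equiv (Dual.toLin (K := K) (A := A)).symm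
  let m : equalizingForms (X.stabilizers e) →ₗ[K] equalizingForms (X.stabilizers e) :=
    (LinearMap.mulLeft K (charDual ω)).restrict fun φ hφ => X.mul_mem_equalizingForms hω hφ
  have hm : Function.Injective m := by
    intro φ ψ h
    have h1 : charDual ω * φ.1 = charDual ω * ψ.1 := congrArg Subtype.val h
    have h2 := congrArg (X.dual.antipode (charDual ω) * ·) h1
    simp only [← mul_assoc, antipode_mul_charDual, one_mul] at h2
    exact Subtype.ext h2
  obtain ⟨φ, hφ⟩ := LinearMap.injective_iff_surjective.mp hm ⟨1, X.one_mem_equalizingForms e⟩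
  have h1 : charDual ω * φ.1 = 1 := congrArg Subtype.val hφ
  rw [← mul_one (X.dual.antipode (charDual ω)), ← h1, ← mul_assoc, antipode_mul_charDual, one_mul]
  exact φ.2

theorem isHopfSubalgebra_span_stabilityCharacters [IsAlgClosed K] [IsSemisimpleRing A] (e : A) :
    X.dual.IsHopfSubalgebra (Submodule.span K (X.stabilityCharacters e)) := by
  have := Fintype.ofFinite G
  have hB := X.span_stabilityCharacters e
  refine ⟨fun h φ hφ => ?_, fun φ hφ => ?_, ?_, ?_, ?_, ?_⟩
  · rw [hB] at hφ ⊢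
    rw [← Submodule.Quotient.mk_eq_zero]
    refine lin_single (f := (equalizingForms (X.stabilizers e)).mkQ ∘ₗ X.dualAct.flip φ) (f' := 0)
      (fun g => ?_) h
    exact (Submodule.Quotient.mk_eq_zero _).mpr (X.transpose_phi_mem_equalizingForms hφ g)
  · rw [hB] at hφ ⊢
    change X.dualCoact φ ∈ _
    rw [X.dualCoact_eq_sum]
    exact sum_mem fun h _ => ⟨(⟨_, X.transpose_proj_mem_equalizingForms hφ h⟩ :
      equalizingForms (X.stabilizers e)) ⊗ₜ MonoidAlgebra.single h 1, rfl⟩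
  · rw [hB]
    exact X.one_mem_equalizingForms e
  · rw [hB]
    exact fun φ hφ ψ hψ => X.mul_mem_equalizingForms hφ hψ
  · change Submodule.span K (X.stabilityCharacters e) ≤
      (LinearMap.range (TensorProduct.map (Submodule.span K (X.stabilityCharacters e)).subtype
        (Submodule.span K (X.stabilityCharacters e)).subtype)).comap
          (Coalgebra.comul (R := K) (A := Dual K A))
    rw [Submodule.span_le]
    intro χ hχ
    have hχ' := Submodule.subset_span (R := K) hχ
    rw [X.stabilityCharacters_eq] at hχ
    obtain ⟨ω, -, rfl⟩ := hχ
    exact ⟨⟨_, hχ'⟩ ⊗ₜ ⟨_, hχ'⟩, (comul_charDual ω).symm⟩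
  · change Submodule.span K (X.stabilityCharacters e) ≤
      (Submodule.span K (X.stabilityCharacters e)).comap X.dual.antipode
    rw [Submodule.span_le]
    intro χ hχ
    rw [SetLike.mem_coe, Submodule.mem_comap, hB]
    rw [X.stabilityCharacters_eq] at hχ
    obtain ⟨ω, hω, rfl⟩ := hχ
    exact X.antipode_charDual_mem (charDual_mem_equalizingForms.mpr hω)

end

/-! ### Primitive idempotents of index one -/

/-- A form that is invariant under `Q_e` vanishes on the components of degree outside `Q_e^⊥`. -/
lemma apply_proj_eq_zero {e : A} {φ : Dual K A}
    (hφ : φ ∈ equalizingForms (X.stabilizers e)) {h : G} (hh : h ∉ perp (X.isotropyGroup e))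
    (a : A) : φ (X.proj h a) = 0 := by
  rw [mem_perp] at hh
  push Not at hh
  obtain ⟨γ, hγ, hne⟩ := hh
  have h1 := hφ (X.psiHom γ) (Or.inr ⟨γ, hγ, rfl⟩) (X.proj h a) 1
  rw [mul_one, mul_one, psiHom_apply, X.psi_proj, map_smul, smul_eq_mul] at h1
  have h2 : ((γ h : K) - 1) * φ (X.proj h a) = 0 := by rw [sub_mul, h1, one_mul, sub_self]
  refine (mul_eq_zero.mp h2).resolve_left fun h3 => hne (Units.ext ?_)
  exact sub_eq_zero.mp h3

lemma apply_phi_eq {e : A} (he : X.index e = 1) {φ : Dual K A}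
    (hφ : φ ∈ equalizingForms (X.stabilizers e)) {h : G} (hh : h ∈ perp (X.isotropyGroup e))
    (a : A) : φ (X.phi h a) = φ a := by
  have h1 := hφ (X.phiHom h) (Or.inl ⟨h, X.perp_le_of_index_eq_one he hh, rfl⟩) a 1
  rwa [mul_one, mul_one] at h1

/-- For index one, the braided product that describes `Δ(a b)` is seen as the ordinary one by two
forms of which the first is invariant under `T_e` and the second under `Q_e`. -/
lemma apply_proj_mul_apply_phi {e : A} (he : X.index e = 1) {φ ψ : Dual K A}
    (hφ : φ ∈ equalizingForms (X.stabilizers e)) (hψ : ψ ∈ equalizingForms (X.stabilizers e))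
    (h : G) (a b : A) : φ (X.phi h b) * ψ (X.proj h a) = φ b * ψ (X.proj h a) := by
  by_cases hh : h ∈ perp (X.isotropyGroup e)
  · rw [X.apply_phi_eq he hφ hh]
  · rw [X.apply_proj_eq_zero hψ hh, mul_zero, mul_zero]

/-- For index one, the stability characters are closed under the convolution product. -/
lemma exists_charDual_eq_mul {e : A} (he : X.index e = 1) {ω ω' : A →ₐ[K] K}
    (hω : charDual ω ∈ equalizingForms (X.stabilizers e))
    (hω' : charDual ω' ∈ equalizingForms (X.stabilizers e)) :
    ∃ η : A →ₐ[K] K, charDual η = charDual ω * charDual ω' := by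
  have := Fintype.ofFinite G
  refine ⟨AlgHom.ofLinearMap (charDual ω * charDual ω').toLin ?_ fun a b => ?_, rfl⟩
  · rw [dual_mul_apply, X.comul_one]
    simp
  · rw [X.mul_apply_mul, dual_mul_apply, dual_mul_apply]
    induction Coalgebra.comul (R := K) a with
    | zero => simp
    | add x y hx hy => simp only [map_add, TensorProduct.add_tmul, add_mul, hx, hy]
    | tmul u v =>
      induction Coalgebra.comul (R := K) b with
      | zero => simp
      | add x y hx hy => simp only [map_add, TensorProduct.tmul_add, mul_add, hx, hy]
      | tmul u' v' =>
        rw [braidedMul_tmul]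
        simp only [map_sum, TensorProduct.map_tmul, LinearMap.mul'_apply, charDual_apply, map_mul]
        have h1 : ∀ h, ω u * ω (X.phi h u') * (ω' (X.proj h v) * ω' v') =
            ω u * ω u' * ω' v' * ω' (X.proj h v) := by
          intro h
          have h2 := X.apply_proj_mul_apply_phi he hω hω' h v u'
          simp only [charDual_apply] at h2
          linear_combination ω u * ω' v' * h2
        simp only [h1]
        rw [← Finset.mul_sum, ← map_sum, X.sum_proj]
        ring

variable [FiniteDimensional K A]

lemma braid_eq_of_index_eq_one {e : A} (he : X.index e = 1) {φ ψ : Dual K A}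
    (hφ : φ ∈ equalizingForms (X.stabilizers e)) (hψ : ψ ∈ equalizingForms (X.stabilizers e)) :
    X.dual.braid (φ ⊗ₜ ψ) = ψ ⊗ₜ φ := by
  have := Fintype.ofFinite G
  have h1 : X.dual.braid (φ ⊗ₜ ψ) =
      ∑ h, transpose (X.proj h) ψ ⊗ₜ[K] transpose (X.phi h) φ := by
    change rightBraid K X.dualAct X.dualCoact (φ ⊗ₜ ψ) = _
    simp only [rightBraid, LinearMap.comp_apply, LinearMap.lTensor_tmul, X.dualCoact_eq_sum,
      TensorProduct.tmul_sum, map_sum]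
    rfl
  rw [h1]
  refine pair_pair _ _ fun a b => ?_
  simp only [map_sum, LinearMap.sum_apply, pairEquiv_tmul, transpose_apply, dual_smul_apply,
    smul_eq_mul, mul_comm (ψ _), X.apply_proj_mul_apply_phi he hφ hψ]
  rw [← Finset.mul_sum, ← map_sum, X.sum_proj]

section IndexOne

variable [IsAlgClosed K] [IsSemisimpleRing A]

lemma mul_mem_stabilityCharacters {e : A} (he : X.index e = 1) {χ χ' : Dual K A}
    (hχ : χ ∈ X.stabilityCharacters e) (hχ' : χ' ∈ X.stabilityCharacters e) :
    χ * χ' ∈ X.stabilityCharacters e := by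
  have h1 := X.stabilityCharacters_eq e
  obtain ⟨ω, -, rfl⟩ := h1 ▸ hχ
  obtain ⟨ω', -, rfl⟩ := h1 ▸ hχ'
  rw [charDual_mem_stabilityCharacters_iff] at hχ hχ'
  obtain ⟨η, hη⟩ := X.exists_charDual_eq_mul he hχ hχ'
  rw [← hη, charDual_mem_stabilityCharacters_iff, hη]
  exact X.mul_mem_equalizingForms hχ hχ'

lemma one_mem_stabilityCharacters (e : A) : 1 ∈ X.stabilityCharacters e := by
  let ε : A →ₐ[K] K := AlgHom.ofLinearMap Coalgebra.counit X.counit_one X.counit_mul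
  have h1 : charDual ε = 1 := rfl
  rw [← h1, charDual_mem_stabilityCharacters_iff, h1]
  exact X.one_mem_equalizingForms e

lemma finite_stabilityCharacters (e : A) : (X.stabilityCharacters e).Finite := by
  rw [stabilityCharacters_eq]
  exact (Set.toFinite _).image _

/-- For index one, the stability characters as a group of units: a finite cancellative monoid is a
group. -/
noncomputable def stabilityGroup {e : A} (he : X.index e = 1) : Subgroup (Dual K A)ˣ where
  carrier := {u | (u : Dual K A) ∈ X.stabilityCharacters e}
  one_mem' := X.one_mem_stabilityCharacters e
  mul_mem' hu hv := X.mul_mem_stabilityCharacters he hu hv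
  inv_mem' {u} hu := by
    have hinj : Set.InjOn ((u : Dual K A) * ·) (X.stabilityCharacters e) :=
      fun χ _ χ' _ h => u.mul_right_inj.mp h
    have hmaps : Set.MapsTo ((u : Dual K A) * ·) (X.stabilityCharacters e)
        (X.stabilityCharacters e) := fun χ hχ => X.mul_mem_stabilityCharacters he hu hχ
    have hfin := (X.finite_stabilityCharacters e).to_subtype
    obtain ⟨⟨χ, hχ⟩, h1⟩ := Finite.surjective_of_injective (hmaps.restrict_inj.mpr hinj)
      ⟨1, X.one_mem_stabilityCharacters e⟩
    have h2 : ((u⁻¹ : (Dual K A)ˣ) : Dual K A) = χ :=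
      Units.inv_eq_of_mul_eq_one_right (congrArg Subtype.val h1)
    change ((u⁻¹ : (Dual K A)ˣ) : Dual K A) ∈ X.stabilityCharacters e
    rwa [h2]

lemma coe_image_stabilityGroup {e : A} (he : X.index e = 1) :
    Units.val '' (X.stabilityGroup he : Set (Dual K A)ˣ) = X.stabilityCharacters e := by
  ext χ
  constructor
  · rintro ⟨u, hu, rfl⟩
    exact hu
  · intro hχ
    obtain ⟨ω, -, rfl⟩ := X.stabilityCharacters_eq e ▸ hχ
    exact ⟨⟨charDual ω, _, X.charDual_mul_antipode ω, X.antipode_mul_charDual ω⟩, hχ, rfl⟩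

lemma isGroupLikeElem_of_mem_stabilityGroup {e : A} (he : X.index e = 1) {u : (Dual K A)ˣ}
    (hu : u ∈ X.stabilityGroup he) : IsGroupLikeElem K (u : Dual K A) := by
  obtain ⟨ω, -, hω⟩ := X.stabilityCharacters_eq e ▸
    (show (u : Dual K A) ∈ X.stabilityCharacters e from hu)
  rw [← hω]
  exact isGroupLikeElem_charDual ω

end IndexOne

end LeftHopfAlgebra

/-! ### The group algebra of a group of units -/

section GroupAlgebraOfUnits

variable {K R : Type*} [Field K] [Ring R] [Algebra K R] (U : Subgroup Rˣ)

lemma lift_units_eq_linearCombination (x : MonoidAlgebra K U) :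
    MonoidAlgebra.lift K R U ((Units.coeHom R).comp U.subtype) x =
      Finsupp.linearCombination K (fun u : U => ((u : Rˣ) : R)) x.coeff := by
  rw [MonoidAlgebra.lift_apply]
  rfl

lemma range_lift_units :
    LinearMap.range (MonoidAlgebra.lift K R U ((Units.coeHom R).comp U.subtype)).toLinearMap =
      Submodule.span K (Units.val '' (U : Set Rˣ)) := by
  have h1 : Units.val '' (U : Set Rˣ) = Set.range fun u : U => ((u : Rˣ) : R) := by
    ext r
    simp
  rw [h1, ← Finsupp.range_linearCombination]
  ext r
  constructor
  · rintro ⟨x, rfl⟩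
    exact ⟨x.coeff, (lift_units_eq_linearCombination U x).symm⟩
  · rintro ⟨x, rfl⟩
    exact ⟨MonoidAlgebra.ofCoeff x, lift_units_eq_linearCombination U _⟩

lemma lift_units_injective [Coalgebra K R] (hU : ∀ u ∈ U, IsGroupLikeElem K (u : R)) :
    Function.Injective (MonoidAlgebra.lift K R U ((Units.coeHom R).comp U.subtype)) := by
  have h1 : LinearIndependent K fun u : U => ((u : Rˣ) : R) :=
    (linearIndepOn_isGroupLikeElem (R := K) (A := R)).comp
      (fun u : U => (⟨(u : Rˣ), hU u u.2⟩ : {a : R | IsGroupLikeElem K a}))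
      fun u v h => Subtype.ext (Units.ext (congrArg Subtype.val h))
  intro x y h
  rw [lift_units_eq_linearCombination, lift_units_eq_linearCombination] at h
  exact MonoidAlgebra.coeff_injective (h1 h)

end GroupAlgebraOfUnits

end YetterDrinfeld

open YetterDrinfeld in
theorem theorem3p6 {K G A : Type*} [Field K] [IsAlgClosed K] [CharZero K] [CommGroup G] [Finite G]
    [CommRing A] [Algebra K A] [Coalgebra K A] [IsSemisimpleRing A]
    (X : LeftHopfAlgebra K (MonoidAlgebra K G) A) :
    ∃ _ : FiniteDimensional K A,
      (∀ e : A, IsPrimitiveIdempotent e → ∃! η : A →ₐ[K] K, IsCharacterOf e η) ∧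
      ∀ e : A, IsPrimitiveIdempotent e →
        X.dual.IsHopfSubalgebra (Submodule.span K (X.stabilityCharacters e)) ∧
        (X.index e = 1 → ∃ U : Subgroup (Dual K A)ˣ,
          Units.val '' (U : Set (Dual K A)ˣ) = X.stabilityCharacters e ∧
          (∀ u ∈ U, IsGroupLikeElem K (u : Dual K A)) ∧
          Function.Injective
            (MonoidAlgebra.lift K (Dual K A) U ((Units.coeHom (Dual K A)).comp U.subtype)) ∧
          LinearMap.range (MonoidAlgebra.lift K (Dual K A) U
              ((Units.coeHom (Dual K A)).comp U.subtype)).toLinearMap =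
            Submodule.span K (X.stabilityCharacters e) ∧
          X.dual.IsTrivialHopfSubalgebra (Submodule.span K (X.stabilityCharacters e))) := by
  have := X.finiteDimensional
  refine ⟨this, fun e he => existsUnique_isCharacterOf he, fun e _ =>
    ⟨X.isHopfSubalgebra_span_stabilityCharacters e, fun hi =>
      ⟨X.stabilityGroup hi, X.coe_image_stabilityGroup hi,
        fun u hu => X.isGroupLikeElem_of_mem_stabilityGroup hi hu,
        lift_units_injective _ fun u hu => X.isGroupLikeElem_of_mem_stabilityGroup hi hu, ?_,
        X.isHopfSubalgebra_span_stabilityCharacters e, ?_⟩⟩⟩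
  · rw [range_lift_units, X.coe_image_stabilityGroup]
  · rw [X.span_stabilityCharacters]
    exact fun φ hφ ψ hψ => X.braid_eq_of_index_eq_one hi hφ hψ
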